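/- **Setting.** Let $\boldsymbol\varepsilon,\boldsymbol\mu:\mathbb R\to\mathbb C^{2\times2}$ be bounded, measurable (for instance piecewise continuous) and $1$-periodic (the transverse blocks of the permittivity and permeability tensors), let $Q=\begin{pmatrix}0&-1\\1&0\end{pmatrix}$, $\mathcal Q=\mathrm{diag}(Q,Q)$, $\mathcal A(z)=\mathrm i\begin{pmatrix}0&\boldsymbol\mu(z)\\-\boldsymbol\varepsilon(z)&0\end{pmatrix}$, and let $\mathcal M(\omega)=\mathcal T(\omega;1)\in\mathbb C^{4\times4}$ be the transfer matrix, where $\mathcal T(\omega;\cdot)$ is the fundamental matrix of $\Phi'=\omega\,\mathcal Q^{-1}\mathcal A(z)\Phi$ with $\mathcal T(\omega;0)=I$. For $\xi\in\mathbb T=\{|\xi|=1\}$ the eigenfrequencies are the $\omega\in\mathbb C$ for which this system has a nonzero solution with $\Phi(z+1)=\xi\Phi(z)$, i.e. the zeros of $\det(\mathcal M(\omega)-\xi I)$; they are counted with their order as zeros. Let $(\omega_n)$ be a labelling of the bands: continuous functions $\omega_n:\mathbb T\to\mathbb C$ whose values at each $\xi\in\mathbb T$ are exactly all the eigenfrequencies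 for $\xi$, listed with multiplicity. Put $\gamma_n=\omega_n(\mathbb T)$, $\Gamma=\bigcup_n\gamma_n$, $\Gamma^c=\mathbb C\setminus\Gamma$. For $\omega\in\mathbb C$ let $\lambda_1(\omega),\dots,\lambda_4(\omega)$ be the eigenvalues of $\mathcal M(\omega)$ with algebraic multiplicity and $$\mathrm{Ind}(\omega)=\tfrac12\big(\#\{i:|\lambda_i(\omega)|<1\}-\#\{i:|\lambda_i(\omega)|>1\}\big).$$ For a connected component $D$ of $\Gamma^c$, $\mathrm{Ind}(D)$ denotes the constant value of $\mathrm{Ind}$ on $D$; $D$ is a principal gapped component if $\mathrm{Ind}(D)=0$. For $\omega_B\notin\gamma_n$ let $$W(\gamma_n;\omega_B)=\frac1{2\pi\mathrm i}\int_{0}^{2\pi}\frac{\frac{d}{d\theta}\,\omega_n(e^{\mathrm i\theta})}{\omega_n(e^{\mathrm i\theta})-\omega_B}\,d\theta .$$ A point $\omega_n(\xi)$, $\xi\in\mathbb T$, is a smooth point of $\gamma_n$ if $\omega_n$ takes this value only at $\xi$ and $\theta\mapsto\omega_n(\xi e^{\mathrm i\theta})$ is $C^\infty$ near $\theta=0$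 with nonzero derivative $T(\xi)$ at $\theta=0$. Let $D_n^e$ be the unbounded component and $D_n^i$ a bounded component of $\mathbb C\setminus\gamma_n$. An outward unit normal at a smooth point $\zeta=\omega_n(\xi)$ of $\gamma_n$ on the boundary of $D_n^i$ is a unit vector $\nu\in\mathbb C$ orthogonal to $T(\xi)$ with $\zeta+t\nu\in D_n^e$ and $\zeta-t\nu\in D_n^i$ for all sufficiently small $t>0$. The boundary $\gamma_n^i$ of $D_n^i$ is positively oriented if at some such smooth point $\nu$ is the direction of $T(\xi)$ rotated clockwise by $\pi/2$, i.e. $\nu=-\mathrm i\,T(\xi)/|T(\xi)|$; otherwise it is negatively oriented. **Theorem.** Assume that $\gamma_n\cap\gamma_m=\emptyset$ for all $m\ne n$. Let $D$ be a principal gapped component, and let $V\subseteq D_n^i$ be a connected component of $\Gamma^c$ (so $V=D_n^i$ if $D_n^i$ contains no point of any other dispersion curve). Assume that there is $\xi_0\in\mathbb T$ such that $\zeta_0=\omega_n(\xi_0)$ is a smooth point of $\gamma_n$ with an outward unit normal $\nu$ at the boundary of $D_n^i$, that $\zeta_0+t\nu\in D$ and $\zeta_0-t\nu\in V$ for all sufficiently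 small $t>0$, and that $\omega_n$ is analytic at $\xi_0$ (near $\xi_0$ it is the restriction to $\mathbb T$ of a holomorphic function). Then $\theta\mapsto\omega_n(e^{\mathrm i\theta})$ is continuously differentiable, and $$\mathrm{Ind}(V)=W(\gamma_n;\omega_B)=\begin{cases}+1&\text{if }\gamma_n^i\text{ is positively oriented},\\-1&\text{if }\gamma_n^i\text{ is negatively oriented},\end{cases}\qquad\text{for all }\omega_B\in D_n^i .$$ In particular, if $D_n^i$ contains no point of any other dispersion curve, then $\mathrm{Ind}(D_n^i)=W(\gamma_n;\omega_B)=\pm1$ accordingly. -/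

import Mathlib

open Set Filter Topology MeasureTheory
open scoped Matrix Interval

noncomputable section

/-! ### The layered medium and its transfer matrix -/

/-- Index set of the four transverse field components `(E_x, E_y, H_x, H_y)`. -/
abbrev FieldIdx := Fin 2 ⊕ Fin 2

/-- A one-dimensional photonic crystal of period `1`: the transverse `2 × 2` blocks of the
permittivity and permeability tensors, as bounded measurable `1`-periodic functions of `z`
(bounded piecewise continuous tensors are a special case). -/
structure PhotonicCrystal where
  eps : ℝ → Matrix (Fin 2) (Fin 2) ℂ
  mu : ℝ → Matrix (Fin 2) (Fin 2) ℂ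
  measurable_eps : ∀ i j, Measurable fun z => eps z i j
  measurable_mu : ∀ i j, Measurable fun z => mu z i j
  bounded_eps : ∃ C : ℝ, ∀ z i j, ‖eps z i j‖ ≤ C
  bounded_mu : ∃ C : ℝ, ∀ z i j, ‖mu z i j‖ ≤ C
  periodic_eps : ∀ z, eps (z + 1) = eps z
  periodic_mu : ∀ z, mu (z + 1) = mu z

/-- The rotation `Q`. -/
def rotQ : Matrix (Fin 2) (Fin 2) ℂ := !![0, -1; 1, 0]

/-- The block diagonal matrix `𝒬 = diag (Q, Q)`. -/
def blockQ : Matrix FieldIdx FieldIdx ℂ := Matrix.fromBlocks rotQ 0 0 rotQ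

namespace PhotonicCrystal

variable (c : PhotonicCrystal)

/-- The matrix `𝒜(z) = i [[0, μ(z)], [-ε(z), 0]]`. -/
def blockA (z : ℝ) : Matrix FieldIdx FieldIdx ℂ :=
  Complex.I • Matrix.fromBlocks 0 (c.mu z) (-c.eps z) 0

/-- The coefficient matrix `𝒬⁻¹ 𝒜(z)` of the first-order Maxwell system. -/
def coeff (z : ℝ) : Matrix FieldIdx FieldIdx ℂ := blockQ⁻¹ * c.blockA z

/-- `Φ` solves the Maxwell system `Φ' = ω 𝒬⁻¹ 𝒜(z) Φ` on `ℝ`: it is continuous and satisfies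
the integrated equation (the usual notion of solution for discontinuous coefficients). -/
def IsSolution (ω : ℂ) (Φ : ℝ → FieldIdx → ℂ) : Prop :=
  Continuous Φ ∧
    ∀ z i, Φ z i = Φ 0 i + ∫ s in (0 : ℝ)..z, ω * (c.coeff s *ᵥ Φ s) i

/-- `ω` is an eigenfrequency of the quasi-periodic problem with multiplier `ξ`:
there is a nonzero solution with `Φ (z + 1) = ξ Φ z`. -/
def IsEigenfrequency (ξ ω : ℂ) : Prop :=
  ∃ Φ : ℝ → FieldIdx → ℂ, c.IsSolution ω Φ ∧ (∀ z, Φ (z + 1) = ξ • Φ z) ∧ Φ ≠ 0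

/-- The iterated integrals of the Peano–Baker series:
`P₀ = I` and `Pₙ₊₁ (z) = ∫₀ᶻ 𝒬⁻¹ 𝒜(s) Pₙ (s) ds`. -/
def iterInt : ℕ → ℝ → Matrix FieldIdx FieldIdx ℂ
  | 0, _ => 1
  | n + 1, z => Matrix.of fun i j => ∫ s in (0 : ℝ)..z, (c.coeff s * iterInt n s) i j

/-- The fundamental matrix `𝒯(ω; z)` of the Maxwell system with `𝒯(ω; 0) = I`, as the sum of its
Peano–Baker series. That its columns solve the system, that `𝒯(ω; 0) = I`, and that every solution
is `Φ z = 𝒯(ω; z) Φ 0`, is proved below. -/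
def fundMatrix (ω : ℂ) (z : ℝ) : Matrix FieldIdx FieldIdx ℂ :=
  Matrix.of fun i j => ∑' n : ℕ, ω ^ n * c.iterInt n z i j

/-- The transfer matrix `ℳ(ω) = 𝒯(ω; 1)` over one period. -/
def transferMatrix (ω : ℂ) : Matrix FieldIdx FieldIdx ℂ := c.fundMatrix ω 1

theorem coeff_add_one (z : ℝ) : c.coeff (z + 1) = c.coeff z := by
  simp only [coeff, blockA, c.periodic_eps, c.periodic_mu]

theorem measurable_coeff (i j : FieldIdx) : Measurable fun z => c.coeff z i j := by
  have hA : ∀ i j, Measurable fun z => c.blockA z i j := by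
    rintro (i | i) (j | j)
    · simp [blockA]
    · simpa [blockA] using (c.measurable_mu i j).const_mul Complex.I
    · simpa [blockA] using (c.measurable_eps i j).const_mul Complex.I
    · simp [blockA]
  simp only [coeff, Matrix.mul_apply]
  exact Finset.measurable_sum _ fun k _ => (hA k j).const_mul _

theorem exists_bound_coeff : ∃ C : ℝ, 0 ≤ C ∧ ∀ z i j, ‖c.coeff z i j‖ ≤ C := by
  obtain ⟨C₁, h₁⟩ := c.bounded_eps
  obtain ⟨C₂, h₂⟩ := c.bounded_mu
  have hC₁ : 0 ≤ C₁ := (norm_nonneg _).trans (h₁ 0 0 0)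
  have hC₂ : 0 ≤ C₂ := (norm_nonneg _).trans (h₂ 0 0 0)
  have hA : ∀ z i j, ‖c.blockA z i j‖ ≤ C₁ + C₂ := by
    rintro z (i | i) (j | j)
    · simpa [blockA] using add_nonneg hC₁ hC₂
    · simpa [blockA] using (h₂ z i j).trans (by linarith)
    · simpa [blockA] using (h₁ z i j).trans (by linarith)
    · simpa [blockA] using add_nonneg hC₁ hC₂
  refine ⟨∑ i, ∑ k, ‖(blockQ⁻¹ : Matrix FieldIdx FieldIdx ℂ) i k‖ * (C₁ + C₂),
    by positivity, fun z i j => ?_⟩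
  simp only [coeff, Matrix.mul_apply]
  calc ‖∑ k, (blockQ⁻¹ : Matrix FieldIdx FieldIdx ℂ) i k * c.blockA z k j‖
      ≤ ∑ k, ‖(blockQ⁻¹ : Matrix FieldIdx FieldIdx ℂ) i k‖ * (C₁ + C₂) := by
        refine (norm_sum_le _ _).trans (Finset.sum_le_sum fun k _ => ?_)
        rw [norm_mul]
        exact mul_le_mul_of_nonneg_left (hA z k j) (norm_nonneg _)
    _ ≤ _ := Finset.single_le_sum
        (f := fun i => ∑ k, ‖(blockQ⁻¹ : Matrix FieldIdx FieldIdx ℂ) i k‖ * (C₁ + C₂))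
        (fun i _ => by positivity) (Finset.mem_univ i)

theorem intervalIntegrable_coeff_mulVec {Φ : ℝ → FieldIdx → ℂ} (hΦ : Continuous Φ)
    (a b : ℝ) (i : FieldIdx) :
    IntervalIntegrable (fun s => (c.coeff s *ᵥ Φ s) i) volume a b := by
  obtain ⟨C, -, hC⟩ := c.exists_bound_coeff
  simp only [Matrix.mulVec, dotProduct]
  have hsum : (fun s => ∑ k, c.coeff s i k * Φ s k) = ∑ k, fun s => c.coeff s i k * Φ s k := by
    funext s; simp
  rw [hsum]
  refine IntervalIntegrable.sum _ fun k _ => ?_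
  have hk : IntervalIntegrable (fun s => Φ s k) volume a b :=
    ((continuous_apply k).comp hΦ).intervalIntegrable a b
  rw [intervalIntegrable_iff] at hk ⊢
  exact hk.bdd_mul (c.measurable_coeff i k).aestronglyMeasurable
    (Eventually.of_forall fun s => hC s i k)

/-- One integration against the coefficient matrix improves a power bound by one order. -/
theorem norm_integral_coeff_le {C : ℝ} (hC : ∀ z i j, ‖c.coeff z i j‖ ≤ C)
    {Φ : ℝ → FieldIdx → ℂ} {R A : ℝ} {n : ℕ}
    (hb : ∀ s, |s| ≤ R → ∀ i, ‖Φ s i‖ ≤ A * |s| ^ n) {z : ℝ} (hz : |z| ≤ R) (i : FieldIdx) :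
    ‖∫ s in (0 : ℝ)..z, (c.coeff s *ᵥ Φ s) i‖ ≤ 4 * C * A * (|z| ^ (n + 1) / (n + 1)) := by
  have hbd : ∀ s ∈ Ι (0 : ℝ) z, ‖(c.coeff s *ᵥ Φ s) i‖ ≤ 4 * C * A * |s - 0| ^ n := by
    intro s hs
    have hsz : |s| ≤ |z| := by
      have := uIoc_subset_uIcc hs
      simpa using abs_sub_left_of_mem_uIcc this
    simp only [Matrix.mulVec, dotProduct, sub_zero]
    calc ‖∑ k, c.coeff s i k * Φ s k‖ ≤ ∑ _k : FieldIdx, C * (A * |s| ^ n) := by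
          refine (norm_sum_le _ _).trans (Finset.sum_le_sum fun k _ => ?_)
          rw [norm_mul]
          exact mul_le_mul (hC s i k) (hb s (hsz.trans hz) k) (norm_nonneg _)
            ((norm_nonneg _).trans (hC s i k))
      _ = _ := by simp; ring
  have hint : IntegrableOn (fun s : ℝ => 4 * C * A * |s - 0| ^ n) (Ι (0 : ℝ) z) := by
    rw [← intervalIntegrable_iff]
    exact Continuous.intervalIntegrable (by fun_prop) _ _
  calc ‖∫ s in (0 : ℝ)..z, (c.coeff s *ᵥ Φ s) i‖
      = ‖∫ s in Ι (0 : ℝ) z, (c.coeff s *ᵥ Φ s) i‖ :=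
        intervalIntegral.norm_integral_eq_norm_integral_uIoc _
    _ ≤ ∫ s in Ι (0 : ℝ) z, 4 * C * A * |s - 0| ^ n :=
        norm_integral_le_of_norm_le hint
          ((ae_restrict_mem measurableSet_uIoc).mono fun s hs => hbd s hs)
    _ = _ := by rw [integral_const_mul, integral_pow_abs_sub_uIoc, sub_zero]

theorem iterInt_succ_apply (n : ℕ) (z : ℝ) (i j : FieldIdx) :
    c.iterInt (n + 1) z i j =
      ∫ s in (0 : ℝ)..z, (c.coeff s *ᵥ fun k => c.iterInt n s k j) i := by
  simp [iterInt, Matrix.mul_apply, Matrix.mulVec, dotProduct]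

theorem continuous_iterInt (n : ℕ) (j : FieldIdx) :
    Continuous fun z => fun i => c.iterInt n z i j := by
  induction n with
  | zero => simpa [iterInt] using continuous_const
  | succ n ih =>
    refine continuous_pi fun i => ?_
    simp only [iterInt_succ_apply]
    exact intervalIntegral.continuous_primitive
      (fun a b => c.intervalIntegrable_coeff_mulVec ih a b i) 0

theorem norm_iterInt_le {C : ℝ} (hC : ∀ z i j, ‖c.coeff z i j‖ ≤ C) (n : ℕ) (z : ℝ)
    (i j : FieldIdx) :
    ‖c.iterInt n z i j‖ ≤ (4 * C) ^ n / (n.factorial : ℝ) * |z| ^ n := by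
  induction n generalizing z i with
  | zero =>
    by_cases h : i = j <;> simp [iterInt, Matrix.one_apply, h]
  | succ n ih =>
    rw [iterInt_succ_apply]
    refine (c.norm_integral_coeff_le hC (R := |z|) (fun s _ k => ih s k) le_rfl i).trans
      (le_of_eq ?_)
    rw [Nat.factorial_succ]
    push_cast
    have : (n.factorial : ℝ) ≠ 0 := by positivity
    have : (n : ℝ) + 1 ≠ 0 := by positivity
    field_simp
    ring

theorem norm_term_le {C : ℝ} (hC : ∀ z i j, ‖c.coeff z i j‖ ≤ C) (ω : ℂ) {R z : ℝ}
    (hz : |z| ≤ R) (n : ℕ) (i j : FieldIdx) :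
    ‖ω ^ n * c.iterInt n z i j‖ ≤ (‖ω‖ * (4 * C) * R) ^ n / (n.factorial : ℝ) := by
  have hC0 : 0 ≤ C := (norm_nonneg _).trans (hC 0 i j)
  rw [norm_mul, norm_pow]
  calc ‖ω‖ ^ n * ‖c.iterInt n z i j‖
      ≤ ‖ω‖ ^ n * ((4 * C) ^ n / (n.factorial : ℝ) * R ^ n) := by
        refine mul_le_mul_of_nonneg_left ((c.norm_iterInt_le hC n z i j).trans ?_) (by positivity)
        gcongr
    _ = _ := by rw [mul_pow, mul_pow]; ring

theorem summable_term (ω : ℂ) (z : ℝ) (i j : FieldIdx) :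
    Summable fun n : ℕ => ω ^ n * c.iterInt n z i j := by
  obtain ⟨C, -, hC⟩ := c.exists_bound_coeff
  exact Summable.of_norm_bounded (Real.summable_pow_div_factorial _)
    fun n => c.norm_term_le hC ω (le_refl |z|) n i j

theorem fundMatrix_zero (ω : ℂ) : c.fundMatrix ω 0 = 1 := by
  ext i j
  simp only [fundMatrix, Matrix.of_apply]
  rw [tsum_eq_single 0]
  · simp [iterInt]
  · intro n hn
    obtain ⟨m, rfl⟩ := Nat.exists_eq_succ_of_ne_zero hn
    simp [iterInt]

theorem continuous_fundMatrix_col (ω : ℂ) (j : FieldIdx) :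
    Continuous fun z => fun i => c.fundMatrix ω z i j := by
  obtain ⟨C, -, hC⟩ := c.exists_bound_coeff
  refine continuous_pi fun i => continuous_iff_continuousAt.2 fun z₀ => ?_
  have h : ContinuousOn (fun z => ∑' n : ℕ, ω ^ n * c.iterInt n z i j)
      (Metric.ball (0 : ℝ) (|z₀| + 1)) := by
    refine continuousOn_tsum (fun n => ?_)
      (Real.summable_pow_div_factorial (‖ω‖ * (4 * C) * (|z₀| + 1))) fun n z hz => ?_
    · exact (continuous_const.mul
        ((continuous_apply i).comp (c.continuous_iterInt n j))).continuousOn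
    · refine c.norm_term_le hC ω ?_ n i j
      simpa using (Metric.mem_ball.1 hz).le
  exact h.continuousAt (Metric.isOpen_ball.mem_nhds (by simp))

/-- The columns of `𝒯(ω; ·)` solve the Maxwell system. -/
theorem isSolution_fundMatrix_col (ω : ℂ) (j : FieldIdx) :
    c.IsSolution ω fun z i => c.fundMatrix ω z i j := by
  obtain ⟨C, hC0, hC⟩ := c.exists_bound_coeff
  refine ⟨c.continuous_fundMatrix_col ω j, fun z i => ?_⟩
  have key : HasSum (fun n : ℕ => ∫ s in (0 : ℝ)..z,
        ω * (c.coeff s *ᵥ fun k => ω ^ n * c.iterInt n s k j) i)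
      (∫ s in (0 : ℝ)..z, ω * (c.coeff s *ᵥ fun k => c.fundMatrix ω s k j) i) := by
    refine intervalIntegral.hasSum_integral_of_dominated_convergence
      (fun n _ => ‖ω‖ * (4 * C) * ((‖ω‖ * (4 * C) * |z|) ^ n / (n.factorial : ℝ)))
      (fun n => ?_) (fun n => ?_) ?_ ?_ ?_
    · have hcont : Continuous fun s : ℝ => fun k => ω ^ n * c.iterInt n s k j :=
        continuous_pi fun k => continuous_const.mul
          ((continuous_apply k).comp (c.continuous_iterInt n j))
      exact (intervalIntegrable_iff.1
        ((c.intervalIntegrable_coeff_mulVec hcont 0 z i).const_mul ω)).aestronglyMeasurable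
    · refine Eventually.of_forall fun s hs => ?_
      have hsz : |s| ≤ |z| := by
        simpa using abs_sub_left_of_mem_uIcc (uIoc_subset_uIcc hs)
      rw [norm_mul, mul_assoc]
      refine mul_le_mul_of_nonneg_left ?_ (norm_nonneg _)
      simp only [Matrix.mulVec, dotProduct]
      calc ‖∑ k, c.coeff s i k * (ω ^ n * c.iterInt n s k j)‖
          ≤ ∑ _k : FieldIdx, C * ((‖ω‖ * (4 * C) * |z|) ^ n / (n.factorial : ℝ)) := by
            refine (norm_sum_le _ _).trans (Finset.sum_le_sum fun k _ => ?_)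
            rw [norm_mul]
            exact mul_le_mul (hC s i k) (c.norm_term_le hC ω hsz n k j) (norm_nonneg _) hC0
        _ = _ := by simp; ring
    · exact Eventually.of_forall fun s _ =>
        (Real.summable_pow_div_factorial _).mul_left _
    · exact intervalIntegrable_const
    · refine Eventually.of_forall fun s _ => HasSum.mul_left ω ?_
      simp only [Matrix.mulVec, dotProduct]
      exact hasSum_sum fun k _ => ((c.summable_term ω s k j).hasSum.mul_left _)
  have hterm : ∀ n : ℕ, (∫ s in (0 : ℝ)..z,
      ω * (c.coeff s *ᵥ fun k => ω ^ n * c.iterInt n s k j) i)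
      = ω ^ (n + 1) * c.iterInt (n + 1) z i j := by
    intro n
    rw [iterInt_succ_apply, ← intervalIntegral.integral_const_mul]
    refine intervalIntegral.integral_congr fun s _ => ?_
    simp only [Matrix.mulVec, dotProduct, Finset.mul_sum]
    exact Finset.sum_congr rfl fun k _ => by ring
  simp only [hterm] at key
  rw [← key.tsum_eq]
  have h0 : c.fundMatrix ω 0 i j = ω ^ 0 * c.iterInt 0 z i j := by
    rw [c.fundMatrix_zero]; simp [iterInt]
  change _ = c.fundMatrix ω 0 i j + _
  rw [h0]
  exact (c.summable_term ω z i j).tsum_eq_zero_add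

/-- A solution that vanishes at `0` vanishes identically. -/
theorem IsSolution.eq_zero {ω : ℂ} {Φ : ℝ → FieldIdx → ℂ} (h : c.IsSolution ω Φ)
    (h0 : Φ 0 = 0) : Φ = 0 := by
  obtain ⟨C, hC0, hC⟩ := c.exists_bound_coeff
  have key : ∀ z i, Φ z i = 0 := by
    intro z i
    obtain ⟨K, hK⟩ := (isCompact_Icc (a := -|z|) (b := |z|)).exists_bound_of_continuousOn
      h.1.continuousOn
    have hb : ∀ n : ℕ, ∀ s, |s| ≤ |z| → ∀ i,
        ‖Φ s i‖ ≤ K * (‖ω‖ * (4 * C)) ^ n / (n.factorial : ℝ) * |s| ^ n := by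
      intro n
      induction n with
      | zero =>
        intro s hs i
        simpa using (norm_le_pi_norm (Φ s) i).trans (hK s (abs_le.1 hs))
      | succ n ih =>
        intro s hs i
        rw [h.2 s i, h0, Pi.zero_apply, zero_add, intervalIntegral.integral_const_mul, norm_mul]
        refine (mul_le_mul_of_nonneg_left (c.norm_integral_coeff_le hC ih hs i)
          (norm_nonneg ω)).trans (le_of_eq ?_)
        rw [Nat.factorial_succ]
        push_cast
        have : (n.factorial : ℝ) ≠ 0 := by positivity
        have : (n : ℝ) + 1 ≠ 0 := by positivity
        field_simp
        ring
    have hlim : Tendsto (fun n : ℕ => K * ((‖ω‖ * (4 * C) * |z|) ^ n / (n.factorial : ℝ)))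
        atTop (𝓝 (K * 0)) :=
      (FloorSemiring.tendsto_pow_div_factorial_atTop _).const_mul K
    rw [mul_zero] at hlim
    refine norm_le_zero_iff.1 (ge_of_tendsto' hlim fun n => ?_)
    refine (hb n z le_rfl i).trans (le_of_eq ?_)
    rw [mul_pow _ |z|]
    ring
  funext z i
  exact key z i

theorem isSolution_mulVec (ω : ℂ) (v : FieldIdx → ℂ) :
    c.IsSolution ω fun z => c.fundMatrix ω z *ᵥ v := by
  refine ⟨continuous_pi fun i => ?_, fun z i => ?_⟩
  · simp only [Matrix.mulVec, dotProduct]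
    exact continuous_finsetSum _ fun k _ =>
      ((continuous_apply i).comp (c.continuous_fundMatrix_col ω k)).mul continuous_const
  · have hcol : ∀ k, c.fundMatrix ω z i k * v k = c.fundMatrix ω 0 i k * v k +
        ∫ s in (0 : ℝ)..z, ω * (c.coeff s *ᵥ fun l => c.fundMatrix ω s l k) i * v k := by
      intro k
      rw [intervalIntegral.integral_mul_const, ← add_mul]
      congr 1
      exact (c.isSolution_fundMatrix_col ω k).2 z i
    have hsum : (∫ s in (0 : ℝ)..z, ω * (c.coeff s *ᵥ (c.fundMatrix ω s *ᵥ v)) i) =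
        ∑ k, ∫ s in (0 : ℝ)..z, ω * (c.coeff s *ᵥ fun l => c.fundMatrix ω s l k) i * v k := by
      rw [← intervalIntegral.integral_finsetSum]
      · refine intervalIntegral.integral_congr fun s _ => ?_
        simp only [Matrix.mulVec, dotProduct, Finset.mul_sum, Finset.sum_mul]
        rw [Finset.sum_comm]
        exact Finset.sum_congr rfl fun k _ => Finset.sum_congr rfl fun l _ => by ring
      · intro k _
        exact ((c.intervalIntegrable_coeff_mulVec
          (c.continuous_fundMatrix_col ω k) 0 z i).const_mul ω).mul_const _
    rw [hsum]
    simp only [Matrix.mulVec, dotProduct]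
    rw [← Finset.sum_add_distrib]
    exact Finset.sum_congr rfl fun k _ => hcol k

theorem IsSolution.sub {ω : ℂ} {Φ Ψ : ℝ → FieldIdx → ℂ} (hΦ : c.IsSolution ω Φ)
    (hΨ : c.IsSolution ω Ψ) : c.IsSolution ω (Φ - Ψ) := by
  refine ⟨hΦ.1.sub hΨ.1, fun z i => ?_⟩
  have : (∫ s in (0 : ℝ)..z, ω * (c.coeff s *ᵥ (Φ - Ψ) s) i) =
      (∫ s in (0 : ℝ)..z, ω * (c.coeff s *ᵥ Φ s) i) -
        ∫ s in (0 : ℝ)..z, ω * (c.coeff s *ᵥ Ψ s) i := by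
    rw [← intervalIntegral.integral_sub]
    · simp only [Pi.sub_apply, Matrix.mulVec_sub, mul_sub]
    · exact (c.intervalIntegrable_coeff_mulVec hΦ.1 0 z i).const_mul ω
    · exact (c.intervalIntegrable_coeff_mulVec hΨ.1 0 z i).const_mul ω
  rw [this]
  simp only [Pi.sub_apply]
  rw [hΦ.2 z i, hΨ.2 z i]
  ring

/-- Every solution is `Φ z = 𝒯(ω; z) Φ 0`: the matrix `𝒯` is the fundamental matrix. -/
theorem IsSolution.eq_fundMatrix_mulVec {ω : ℂ} {Φ : ℝ → FieldIdx → ℂ} (h : c.IsSolution ω Φ)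
    (z : ℝ) : Φ z = c.fundMatrix ω z *ᵥ Φ 0 := by
  have := IsSolution.eq_zero c (h.sub c (c.isSolution_mulVec ω (Φ 0))) (by
    simp [c.fundMatrix_zero])
  exact sub_eq_zero.1 (congrFun this z)

theorem IsSolution.comp_add_one {ω : ℂ} {Φ : ℝ → FieldIdx → ℂ} (h : c.IsSolution ω Φ) :
    c.IsSolution ω fun z => Φ (z + 1) := by
  refine ⟨h.1.comp (continuous_add_const 1), fun z i => ?_⟩
  have hshift : (∫ s in (0 : ℝ)..z, ω * (c.coeff s *ᵥ Φ (s + 1)) i) =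
      ∫ s in (1 : ℝ)..(z + 1), ω * (c.coeff s *ᵥ Φ s) i := by
    have := intervalIntegral.integral_comp_add_right (a := 0) (b := z)
      (fun s => ω * (c.coeff s *ᵥ Φ s) i) 1
    simpa [c.coeff_add_one] using this
  have hi : ∀ a b, IntervalIntegrable (fun s => ω * (c.coeff s *ᵥ Φ s) i) volume a b :=
    fun a b => (c.intervalIntegrable_coeff_mulVec h.1 a b i).const_mul ω
  change Φ (z + 1) i = Φ (0 + 1) i + ∫ s in (0 : ℝ)..z, ω * (c.coeff s *ᵥ Φ (s + 1)) i
  rw [hshift, h.2 (z + 1) i, zero_add, h.2 1 i, add_assoc,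
    intervalIntegral.integral_add_adjacent_intervals (hi 0 1) (hi 1 (z + 1))]

/-- The characteristic function `det (ℳ(ω) - ξ I)`, whose zeros `ω` are the eigenfrequencies of
the quasi-periodic problem with multiplier `ξ`. -/
def charDet (ξ ω : ℂ) : ℂ :=
  (c.transferMatrix ω - ξ • (1 : Matrix FieldIdx FieldIdx ℂ)).det

/-- The eigenfrequencies with multiplier `ξ` are exactly the zeros of the characteristic
function. -/
theorem isEigenfrequency_iff (ξ ω : ℂ) : c.IsEigenfrequency ξ ω ↔ c.charDet ξ ω = 0 := by
  rw [charDet, ← Matrix.exists_mulVec_eq_zero_iff]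
  have hmul : ∀ v : FieldIdx → ℂ,
      (c.transferMatrix ω - ξ • (1 : Matrix FieldIdx FieldIdx ℂ)) *ᵥ v
        = c.fundMatrix ω 1 *ᵥ v - ξ • v := fun v => by
    rw [Matrix.sub_mulVec, Matrix.smul_mulVec, Matrix.one_mulVec, transferMatrix]
  constructor
  · rintro ⟨Φ, hΦ, hq, hne⟩
    refine ⟨Φ 0, fun h0 => hne (IsSolution.eq_zero c hΦ h0), ?_⟩
    rw [hmul, ← IsSolution.eq_fundMatrix_mulVec c hΦ 1, sub_eq_zero]
    simpa using hq 0
  · rintro ⟨v, hv, h⟩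
    rw [hmul, sub_eq_zero] at h
    have hsol := c.isSolution_mulVec ω v
    refine ⟨_, hsol, fun z => ?_, fun h0 => hv ?_⟩
    · have h1 := IsSolution.eq_fundMatrix_mulVec c (IsSolution.comp_add_one c hsol) z
      simp only [zero_add] at h1
      rw [h1, h, Matrix.mulVec_smul]
    · simpa [c.fundMatrix_zero] using congrFun h0 0

/-! ### Bands and the index -/

/-- `ω = (ωₙ)ₙ` is a labelling of the band structure: each `ωₙ` is a continuous function on the
unit circle and, for every multiplier `ξ` on the circle, the values `ωₙ(ξ)` exhaust the
eigenfrequencies, each one listed as often as its algebraic multiplicity (its order as a zero of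
`det (ℳ(·) - ξ I)`). -/
def IsBandLabelling {ι : Type*} (ω : ι → Circle → ℂ) : Prop :=
  (∀ n, Continuous (ω n)) ∧
    ∀ (ξ : Circle) (w : ℂ), {n | ω n ξ = w}.encard = analyticOrderAt (c.charDet ξ) w

/-- `Ind(w) = (#{i : |λᵢ(w)| < 1} - #{i : |λᵢ(w)| > 1}) / 2`, where `λ₁, …, λ₄` are the eigenvalues
of `ℳ(w)` with algebraic multiplicity. -/
def index (w : ℂ) : ℚ :=
  (((c.transferMatrix w).charpoly.roots.countP fun l => ‖l‖ < 1 : ℕ) -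
    ((c.transferMatrix w).charpoly.roots.countP fun l => 1 < ‖l‖ : ℕ) : ℚ) / 2

end PhotonicCrystal

/-! ### Plane topology: components, exterior, normals and orientation -/

/-- `D` is a connected component of the set `S`. -/
def IsComponentOf (D S : Set ℂ) : Prop := ∃ w ∈ S, D = connectedComponentIn S w

/-- The union `Γ` of the dispersion curves `γₙ = ωₙ(𝕋)`. -/
def dispersionSet {ι : Type*} (ω : ι → Circle → ℂ) : Set ℂ := ⋃ n, range (ω n)

/-- `D` is a principal gapped component: a connected component of `Γᶜ` on which the index is `0`
(the index is constant on components of `Γᶜ`, so one point of `D` decides). -/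
def IsPrincipalGapped (c : PhotonicCrystal) {ι : Type*} (ω : ι → Circle → ℂ) (D : Set ℂ) : Prop :=
  IsComponentOf D (dispersionSet ω)ᶜ ∧ ∃ w ∈ D, c.index w = 0

/-- The unbounded component of the complement of a closed curve `g`. -/
def exteriorOf (g : Circle → ℂ) : Set ℂ :=
  {w | w ∉ range g ∧ ¬ Bornology.IsBounded (connectedComponentIn (range g)ᶜ w)}

/-- The tangent vector `d/dt g(ξ e^{it})` at `t = 0`, that is `g'(ξ) τ` with `τ = i ξ` the
counterclockwise unit tangent vector of the unit circle at `ξ`. -/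
def tangentVec (g : Circle → ℂ) (ξ : Circle) : ℂ :=
  deriv (fun t : ℝ => g (ξ * Circle.exp t)) 0

/-- `g ξ` is a smooth point of the closed curve `g`: the curve passes through it only once, and is
smooth with nonzero tangent vector there. -/
def IsSmoothPoint (g : Circle → ℂ) (ξ : Circle) : Prop :=
  (∀ ξ', g ξ' = g ξ → ξ' = ξ) ∧
    ContDiffAt ℝ (⊤ : ℕ∞) (fun t : ℝ => g (ξ * Circle.exp t)) 0 ∧ tangentVec g ξ ≠ 0

/-- `ν` is the outward unit normal of the curve `g` at `g ξ`, seen from the component `U` of its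
complement: `ν` is a unit vector orthogonal to the tangent vector which points into the unbounded
component, while `-ν` points into `U`. -/
def IsOutwardNormal (g : Circle → ℂ) (U : Set ℂ) (ξ : Circle) (ν : ℂ) : Prop :=
  ‖ν‖ = 1 ∧ inner ℝ ν (tangentVec g ξ) = 0 ∧
    ∀ᶠ t : ℝ in 𝓝[>] 0, g ξ + t * ν ∈ exteriorOf g ∧ g ξ - t * ν ∈ U

/-- The boundary of the component `U` is positively oriented by `g`: at a smooth point with an
outward unit normal `ν`, `ν` is the direction of the tangent vector rotated clockwise by `π / 2`. -/
def IsPositivelyOriented (g : Circle → ℂ) (U : Set ℂ) : Prop :=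
  ∃ ξ ν, IsSmoothPoint g ξ ∧ IsOutwardNormal g U ξ ν ∧
    (‖tangentVec g ξ‖ : ℂ) * ν = -Complex.I * tangentVec g ξ

/-- `g` is complex analytic at `ξ`: near `ξ` it is the restriction to the unit circle of a
function that is analytic at `ξ`. -/
def IsAnalyticAtCircle (g : Circle → ℂ) (ξ : Circle) : Prop :=
  ∃ F : ℂ → ℂ, AnalyticAt ℂ F ξ ∧ ∀ᶠ ξ' in 𝓝 ξ, g ξ' = F ξ'

/-- The winding number `W(g; w) = (2πi)⁻¹ ∮ dg / (g - w)`, over `ξ = e^{iθ}`, `0 ≤ θ ≤ 2π`. -/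
def windingNumber (g : Circle → ℂ) (w : ℂ) : ℂ :=
  (2 * Real.pi * Complex.I)⁻¹ *
    ∫ θ in (0 : ℝ)..(2 * Real.pi),
      tangentVec g (Circle.exp θ) / (g (Circle.exp θ) - w)

end

/-!
Let `F(ξ, ω) = det (ℳ(ω) - ξ)`, a polynomial in `ξ` with entire coefficients. Since `γₙ` meets no
other band, `ωₙ(ξ)` is listed once among the eigenfrequencies for `ξ`, so it is a simple zero of
`F(ξ, ·)`. By the implicit function theorem `ωₙ` is locally the restriction to the circle of a
holomorphic branch `G` (`IsBandLabelling.exists_local_branch`), and hence continuously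
differentiable.

Winding number. The derivative of `w ↦ W(γₙ; w)` is the integral of the derivative of a periodic
function, so `W` is constant on the components of the complement of `γₙ`; as it tends to `0` at
infinity, it vanishes on the exterior. Across a point that `γₙ` passes once with nonzero velocity
it jumps by `1` from the right to the left side (`tendsto_windingNumber_jump`): on a short arc the
integral is a difference of principal logarithms, and the two sides see different branches. Hence
`W = ±1` on `Dₙⁱ`, according to the direction of the outward normal at any smooth point; in
particular all smooth points yield the same orientation.

Index. Off the dispersion curves `ℳ(ω)` has no eigenvalue on the unit circle, so the index is the
number of eigenvalues in the open unit disc minus `2`, and that number is locally constant by the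
argument principle (`isLocallyConstant_rootCountDisc`). At a smooth point `ζ₀ = ωₙ(ξ₀)` the only
eigenvalue on the circle is `ξ₀`, and it is simple. The local inverse of `G` continues it to a
branch of eigenvalues which moves radially when `ω` moves along the normal of `γₙ`, since
`dω = -i T / |T| · t` corresponds to `dξ = ξ₀ t / |T|`. It lies outside the disc on the right side
of `γₙ` and inside on the left side, while the other eigenvalues stay away from the circle: the
index also jumps by `1` from right to left (`IsBandLabelling.index_eq_index_add_one`). Starting
from index `0` and winding number `0` on the outer side, both reach the same value `±1` inside.
-/

noncomputable section

/-! ### Winding numbers of continuously differentiable closed curves -/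

section Winding

variable {h : ℝ → ℂ}

theorem exists_pos_le_norm_of_ne_zero (hh : Continuous h) {b c : ℝ} (hbc : b ≤ c)
    (hne : ∀ θ ∈ Icc b c, h θ ≠ 0) : ∃ m : ℝ, 0 < m ∧ ∀ θ ∈ Icc b c, m ≤ ‖h θ‖ := by
  obtain ⟨θ, hθ, hmin⟩ := isCompact_Icc.exists_isMinOn (nonempty_Icc.2 hbc) hh.norm.continuousOn
  exact ⟨‖h θ‖, norm_pos_iff.2 (hne θ hθ), fun θ' hθ' => hmin hθ'⟩

/-- If `h` does not vanish on `[b, c]`, the logarithmic integral `∫ h' / (h - u)` over `[b, c]`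
depends continuously on the parameter `u` at `0`. -/
theorem continuousAt_integral_deriv_div_sub (hh : ContDiff ℝ 1 h) {b c : ℝ} (hbc : b ≤ c)
    (hne : ∀ θ ∈ Icc b c, h θ ≠ 0) :
    ContinuousAt (fun u : ℂ => ∫ θ in b..c, deriv h θ / (h θ - u)) 0 := by
  have hd : Continuous (deriv h) := hh.continuous_deriv le_rfl
  obtain ⟨m, hm0, hm⟩ := exists_pos_le_norm_of_ne_zero hh.continuous hbc hne
  have hsub : ∀ u : ℂ, ‖u‖ < m / 2 → ∀ θ ∈ Icc b c, m / 2 ≤ ‖h θ - u‖ := by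
    intro u hu θ hθ
    have := norm_sub_norm_le (h θ) u
    linarith [hm θ hθ]
  have hioc : ∀ {θ}, θ ∈ Ι b c → θ ∈ Icc b c := fun {θ} hθ => by
    rw [uIoc_of_le hbc] at hθ; exact Ioc_subset_Icc_self hθ
  have hball : ∀ᶠ u : ℂ in 𝓝 0, ‖u‖ < m / 2 := by
    filter_upwards [Metric.ball_mem_nhds (0 : ℂ) (half_pos hm0)] with u hu
    simpa using hu
  refine intervalIntegral.continuousAt_of_dominated_interval
    (bound := fun θ => ‖deriv h θ‖ / (m / 2)) ?_ ?_ ?_ ?_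
  · exact Eventually.of_forall fun u =>
      (hd.measurable.div (hh.continuous.measurable.sub_const u)).aestronglyMeasurable
  · filter_upwards [hball] with u hu
    refine Eventually.of_forall fun θ hθ => ?_
    rw [norm_div]
    gcongr
    exact hsub u hu θ (hioc hθ)
  · exact Continuous.intervalIntegrable (by fun_prop) _ _
  · refine Eventually.of_forall fun θ hθ => ?_
    refine ContinuousAt.div (by fun_prop) (by fun_prop) ?_
    simpa using hne θ (hioc hθ)

/-- On an arc that stays in the slit plane, the logarithmic integral is a difference of principal
logarithms. -/
theorem integral_deriv_div_add_eq_log (hh : ContDiff ℝ 1 h) {a b : ℝ} {t : ℂ}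
    (hs : ∀ θ ∈ uIcc a b, h θ + t ∈ Complex.slitPlane) :
    ∫ θ in a..b, deriv h θ / (h θ + t) = Complex.log (h b + t) - Complex.log (h a + t) := by
  have hd : Continuous (deriv h) := hh.continuous_deriv le_rfl
  refine intervalIntegral.integral_eq_sub_of_hasDerivAt
    (f := fun θ => Complex.log (h θ + t)) (fun θ hθ => ?_) ?_
  · exact (((hh.differentiable one_ne_zero) θ).hasDerivAt.add_const t).clog_real (hs θ hθ)
  · exact (hd.continuousOn.div (hh.continuous.continuousOn.add continuousOn_const)
      fun θ hθ => Complex.slitPlane_ne_zero (hs θ hθ)).intervalIntegrable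

/-- Jump of the logarithmic integral across a point through which the arc passes once,
transversally to the real axis. On the short arc over `[a, b]` the integral is evaluated with the
principal logarithm for `h + t` and for `-h + t`; the two differ in the limit by `iπ` at each
end. The long arc over `[b, c]` contributes nothing in the limit. -/
theorem tendsto_integral_jump (hh : ContDiff ℝ 1 h) {a b c p : ℝ} (hap : a < p) (hpb : p < b)
    (hbc : b ≤ c) (hp : h p = 0) (hpos : ∀ θ ∈ Ico a p, 0 < (h θ).im)
    (hneg : ∀ θ ∈ Ioc p b, (h θ).im < 0) (hne : ∀ θ ∈ Icc b c, h θ ≠ 0) :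
    Tendsto (fun t : ℝ => (∫ θ in a..c, deriv h θ / (h θ - t)) -
      ∫ θ in a..c, deriv h θ / (h θ + t)) (𝓝[>] 0) (𝓝 (2 * Real.pi * Complex.I)) := by
  have hd : Continuous (deriv h) := hh.continuous_deriv le_rfl
  have hab : a ≤ b := (hap.trans hpb).le
  have ha : 0 < (h a).im := hpos a ⟨le_rfl, hap⟩
  have hb : (h b).im < 0 := hneg b ⟨hpb, le_rfl⟩
  have hcases : ∀ θ ∈ uIcc a b, h θ = 0 ∨ (h θ).im ≠ 0 := by
    intro θ hθ
    rw [uIcc_of_le hab] at hθ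
    rcases lt_trichotomy θ p with h1 | h1 | h1
    · exact Or.inr (hpos θ ⟨hθ.1, h1⟩).ne'
    · exact Or.inl (h1 ▸ hp)
    · exact Or.inr (hneg θ ⟨h1, hθ.2⟩).ne
  have hslit₁ : ∀ t : ℝ, 0 < t → ∀ θ ∈ uIcc a b, h θ + t ∈ Complex.slitPlane := by
    intro t ht θ hθ
    rw [Complex.mem_slitPlane_iff]
    rcases hcases θ hθ with h0 | h0
    · left; simpa [h0] using ht
    · right; simpa using h0
  have hslit₂ : ∀ t : ℝ, 0 < t → ∀ θ ∈ uIcc a b, (-h) θ + t ∈ Complex.slitPlane := by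
    intro t ht θ hθ
    rw [Complex.mem_slitPlane_iff]
    rcases hcases θ hθ with h0 | h0
    · left; simpa [h0] using ht
    · right; simpa using h0
  -- the short arc
  have hneg' : ∀ t : ℝ, ∀ θ, deriv h θ / (h θ - t) = deriv (-h) θ / ((-h) θ + t) := by
    intro t θ
    rw [deriv.neg, ← neg_div_neg_eq]
    simp only [Pi.neg_apply]
    congr 1
    ring
  have hshort : Tendsto (fun t : ℝ => (∫ θ in a..b, deriv h θ / (h θ - t)) -
      ∫ θ in a..b, deriv h θ / (h θ + t)) (𝓝[>] 0) (𝓝 (2 * Real.pi * Complex.I)) := by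
    have hval : ((Complex.log (-h b + (0 : ℝ)) - Complex.log (-h a + (0 : ℝ))) -
        (Complex.log (h b + (0 : ℝ)) - Complex.log (h a + (0 : ℝ)))) =
          2 * Real.pi * Complex.I := by
      simp only [Complex.log, norm_neg, Complex.ofReal_zero, add_zero,
        Complex.arg_neg_eq_arg_sub_pi_of_im_pos ha, Complex.arg_neg_eq_arg_add_pi_of_im_neg hb]
      push_cast
      ring
    have hlog : ∀ z : ℂ, z.im ≠ 0 →
        Tendsto (fun t : ℝ => Complex.log (z + t)) (𝓝 0) (𝓝 (Complex.log (z + (0 : ℝ)))) := by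
      intro z hz
      have : ContinuousAt (fun t : ℝ => Complex.log (z + t)) 0 :=
        ContinuousAt.clog (by fun_prop) (Or.inr (by simpa using hz))
      exact this
    rw [← hval]
    refine Tendsto.congr' ?_ ((((hlog (-h b) (by simpa using hb.ne)).sub
      (hlog (-h a) (by simpa using ha.ne'))).sub ((hlog (h b) hb.ne).sub
      (hlog (h a) ha.ne'))).mono_left nhdsWithin_le_nhds)
    filter_upwards [self_mem_nhdsWithin] with t ht
    rw [integral_deriv_div_add_eq_log hh (hslit₁ t ht)]
    simp only [hneg']
    rw [integral_deriv_div_add_eq_log (h := -h) hh.neg (hslit₂ t ht)]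
    rfl
  -- the long arc
  have hlong : Tendsto (fun t : ℝ => (∫ θ in b..c, deriv h θ / (h θ - t)) -
      ∫ θ in b..c, deriv h θ / (h θ + t)) (𝓝[>] 0) (𝓝 0) := by
    have hc := continuousAt_integral_deriv_div_sub hh hbc hne
    have h1 : Tendsto (fun t : ℝ => ∫ θ in b..c, deriv h θ / (h θ - t)) (𝓝 0)
        (𝓝 (∫ θ in b..c, deriv h θ / (h θ - 0))) :=
      hc.tendsto.comp (by simpa using (Complex.continuous_ofReal.tendsto 0))
    have h2 : Tendsto (fun t : ℝ => ∫ θ in b..c, deriv h θ / (h θ - (-t : ℂ))) (𝓝 0)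
        (𝓝 (∫ θ in b..c, deriv h θ / (h θ - 0))) :=
      hc.tendsto.comp (by simpa using (Complex.continuous_ofReal.tendsto 0).neg)
    simpa using (h1.sub h2).mono_left nhdsWithin_le_nhds
  have hsplit : ∀ k : ℝ → ℂ, Continuous k → (∀ θ ∈ uIcc a b, k θ ≠ 0) →
      (∀ θ ∈ Icc b c, k θ ≠ 0) → ∫ θ in a..c, deriv h θ / k θ =
        (∫ θ in a..b, deriv h θ / k θ) + ∫ θ in b..c, deriv h θ / k θ := by
    intro k hk h1 h2
    refine (intervalIntegral.integral_add_adjacent_intervals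
      (hd.continuousOn.div hk.continuousOn h1).intervalIntegrable
      (hd.continuousOn.div hk.continuousOn ?_).intervalIntegrable).symm
    rwa [uIcc_of_le hbc]
  obtain ⟨m, hm0, hm⟩ := exists_pos_le_norm_of_ne_zero hh.continuous hbc hne
  have hsum := hshort.add hlong
  rw [add_zero] at hsum
  refine hsum.congr' ?_
  filter_upwards [Ioo_mem_nhdsGT hm0] with t ht
  have htn : ‖(t : ℂ)‖ < m := by simpa [abs_of_pos ht.1] using ht.2
  rw [hsplit (fun θ => h θ - t) (by have := hh.continuous; fun_prop) ?_ ?_,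
    hsplit (fun θ => h θ + t) (by have := hh.continuous; fun_prop) ?_ ?_]
  · ring
  · exact fun θ hθ => Complex.slitPlane_ne_zero (hslit₁ t ht.1 θ hθ)
  · intro θ hθ h0
    have := hm θ hθ
    rw [eq_neg_of_add_eq_zero_left h0, norm_neg] at this
    linarith
  · intro θ hθ h0
    refine Complex.slitPlane_ne_zero (hslit₂ t ht.1 θ hθ) ?_
    simp only [Pi.neg_apply]
    linear_combination -h0
  · intro θ hθ h0
    have := hm θ hθ
    rw [sub_eq_zero.1 h0] at this
    linarith

end Winding

section CircleCurve

variable {g : Circle → ℂ}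

theorem tangentVec_exp (g : Circle → ℂ) (θ : ℝ) :
    tangentVec g (Circle.exp θ) = deriv (fun s : ℝ => g (Circle.exp s)) θ := by
  simp only [tangentVec, ← Circle.exp_add]
  simpa using deriv_comp_const_add (fun s : ℝ => g (Circle.exp s)) θ 0

theorem exists_circleExp_eq (ξ : Circle) : ∃ θ : ℝ, Circle.exp θ = ξ :=
  ⟨Complex.arg ξ, Circle.exp_arg ξ⟩

/-- The winding number as a logarithmic integral over an arbitrary period. -/
theorem windingNumber_eq (g : Circle → ℂ) (w : ℂ) (a : ℝ) :
    windingNumber g w = (2 * Real.pi * Complex.I)⁻¹ * ∫ θ in a..(a + 2 * Real.pi),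
      deriv (fun s : ℝ => g (Circle.exp s)) θ / (g (Circle.exp θ) - w) := by
  have hper : Function.Periodic
      (fun θ : ℝ => tangentVec g (Circle.exp θ) / (g (Circle.exp θ) - w)) (2 * Real.pi) := by
    intro θ
    simp only [Circle.periodic_exp θ]
  simp only [← tangentVec_exp, windingNumber]
  rw [hper.intervalIntegral_add_eq a 0, zero_add]

theorem isCompact_range_of_contDiff (hg : ContDiff ℝ 1 fun θ : ℝ => g (Circle.exp θ)) :
    IsCompact (range g) := by
  have : range g = (fun θ : ℝ => g (Circle.exp θ)) '' Icc 0 (2 * Real.pi) := by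
    refine subset_antisymm ?_ (by rintro _ ⟨θ, -, rfl⟩; exact ⟨_, rfl⟩)
    rintro _ ⟨ξ, rfl⟩
    obtain ⟨θ, rfl⟩ := exists_circleExp_eq ξ
    obtain ⟨y, hy, hy'⟩ := Circle.periodic_exp.exists_mem_Ico₀ Real.two_pi_pos θ
    exact ⟨y, Ico_subset_Icc_self hy, by simp [hy']⟩
  rw [this]
  exact isCompact_Icc.image hg.continuous

/-- The winding number has derivative `0` off the curve, because the differentiated integrand is
the derivative of the periodic function `-1 / (g - w)`. -/
theorem hasDerivAt_windingNumber (hg : ContDiff ℝ 1 fun θ : ℝ => g (Circle.exp θ)) {w : ℂ}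
    (hw : w ∈ (range g)ᶜ) : HasDerivAt (windingNumber g) 0 w := by
  set γ : ℝ → ℂ := fun θ => g (Circle.exp θ) with hγ
  have hd : Continuous (deriv γ) := hg.continuous_deriv le_rfl
  have hc : Continuous γ := hg.continuous
  obtain ⟨m, hm0, hm⟩ := Metric.isOpen_iff.1 (isCompact_range_of_contDiff hg).isClosed.isOpen_compl
    w hw
  have hdist : ∀ u ∈ Metric.ball w (m / 2), ∀ θ, m / 2 ≤ ‖γ θ - u‖ := by
    intro u hu θ
    by_contra! hlt
    refine hm (a := γ θ) ?_ ⟨_, rfl⟩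
    rw [Metric.mem_ball, dist_eq_norm] at hu ⊢
    linarith [norm_sub_le_norm_sub_add_norm_sub (γ θ) u w]
  have hne : ∀ u ∈ Metric.ball w (m / 2), ∀ θ, γ θ - u ≠ 0 := fun u hu θ =>
    norm_pos_iff.1 ((half_pos hm0).trans_le (hdist u hu θ))
  have hwm : w ∈ Metric.ball w (m / 2) := Metric.mem_ball_self (half_pos hm0)
  have key := intervalIntegral.hasDerivAt_integral_of_dominated_loc_of_deriv_le
    (μ := volume) (a := 0) (b := 2 * Real.pi) (x₀ := w) (s := Metric.ball w (m / 2))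
    (F := fun u θ => deriv γ θ / (γ θ - u)) (F' := fun u θ => deriv γ θ / (γ θ - u) ^ 2)
    (bound := fun θ => ‖deriv γ θ‖ / (m / 2) ^ 2) (Metric.ball_mem_nhds w (half_pos hm0))
    (Eventually.of_forall fun u =>
      (hd.measurable.div (hc.measurable.sub_const u)).aestronglyMeasurable)
    ((hd.div (hc.sub continuous_const) (hne w hwm)).intervalIntegrable _ _)
    (hd.measurable.div ((hc.measurable.sub_const w).pow_const 2)).aestronglyMeasurable
    (Eventually.of_forall fun θ _ u hu => by
      rw [norm_div, norm_pow]
      gcongr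
      exact hdist u hu θ)
    (Continuous.intervalIntegrable (by fun_prop) _ _)
    (Eventually.of_forall fun θ _ u hu => by
      have := (((hasDerivAt_id u).const_sub (γ θ)).inv (hne u hu θ)).const_mul (deriv γ θ)
      simpa [div_eq_mul_inv] using this)
  have hzero : ∫ θ in (0 : ℝ)..(2 * Real.pi), deriv γ θ / (γ θ - w) ^ 2 = 0 := by
    rw [intervalIntegral.integral_eq_sub_of_hasDerivAt (f := fun θ => -(γ θ - w)⁻¹)]
    · have : γ (2 * Real.pi) = γ 0 := by
        simp [hγ]
      simp [this]
    · intro θ _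
      have := ((((hg.differentiable one_ne_zero) θ).hasDerivAt.sub_const w).inv
        (hne w hwm θ)).neg
      rwa [neg_div, neg_neg] at this
    · exact (hd.div ((hc.sub continuous_const).pow 2)
        fun θ => pow_ne_zero 2 (hne w hwm θ)).intervalIntegrable _ _
  have h2 := key.2.const_mul (2 * Real.pi * Complex.I : ℂ)⁻¹
  rw [hzero, mul_zero] at h2
  refine h2.congr_of_eventuallyEq (Eventually.of_forall fun u => ?_)
  simpa using windingNumber_eq g u 0

theorem windingNumber_eq_of_mem_connectedComponentIn
    (hg : ContDiff ℝ 1 fun θ : ℝ => g (Circle.exp θ)) {w u v : ℂ}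
    (hu : u ∈ connectedComponentIn (range g)ᶜ w) (hv : v ∈ connectedComponentIn (range g)ᶜ w) :
    windingNumber g u = windingNumber g v := by
  have hopen := (isCompact_range_of_contDiff hg).isClosed.isOpen_compl
  have hd : ∀ z ∈ connectedComponentIn (range g)ᶜ w, HasDerivAt (windingNumber g) 0 z :=
    fun z hz => hasDerivAt_windingNumber hg (connectedComponentIn_subset _ _ hz)
  exact hopen.connectedComponentIn.is_const_of_deriv_eq_zero isPreconnected_connectedComponentIn
    (fun z hz => (hd z hz).differentiableAt.differentiableWithinAt)
    (fun z hz => (hd z hz).deriv) hu hv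

/-- The winding number vanishes on the exterior: it is constant there and tends to `0` at
infinity. -/
theorem windingNumber_eq_zero_of_mem_exteriorOf
    (hg : ContDiff ℝ 1 fun θ : ℝ => g (Circle.exp θ)) {w : ℂ} (hw : w ∈ exteriorOf g) :
    windingNumber g w = 0 := by
  obtain ⟨hw, hub⟩ := hw
  set γ : ℝ → ℂ := fun θ => g (Circle.exp θ) with hγ
  have hd : Continuous (deriv γ) := hg.continuous_deriv le_rfl
  obtain ⟨K, hK⟩ := (isCompact_Icc (a := (0 : ℝ)) (b := 2 * Real.pi)).exists_bound_of_continuousOn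
    hd.continuousOn
  obtain ⟨R, hR⟩ := (isCompact_range_of_contDiff hg).isBounded.exists_norm_le
  by_contra hne
  have hpos : 0 < ‖windingNumber g w‖ := norm_pos_iff.2 hne
  have hpi := Real.pi_pos
  have hK0 : 0 ≤ K := (norm_nonneg _).trans (hK 0 ⟨le_rfl, Real.two_pi_pos.le⟩)
  obtain ⟨u, hu, huR⟩ : ∃ u ∈ connectedComponentIn (range g)ᶜ w,
      R + (K + 1) / ‖windingNumber g w‖ < ‖u‖ := by
    by_contra! hall
    exact hub (isBounded_iff_forall_norm_le.2 ⟨_, hall⟩)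
  have hL : 0 < (K + 1) / ‖windingNumber g w‖ := by positivity
  have heq := windingNumber_eq_of_mem_connectedComponentIn hg hu
    (mem_connectedComponentIn (x := w) hw)
  have hint : ‖∫ θ in (0 : ℝ)..(0 + 2 * Real.pi), deriv γ θ / (γ θ - u)‖ ≤
      K / ((K + 1) / ‖windingNumber g w‖) * |(0 + 2 * Real.pi) - 0| := by
    refine intervalIntegral.norm_integral_le_of_norm_le_const fun θ hθ => ?_
    rw [zero_add, uIoc_of_le Real.two_pi_pos.le] at hθ
    rw [norm_div]
    have h1 := hK θ (Ioc_subset_Icc_self hθ)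
    have h2 : (K + 1) / ‖windingNumber g w‖ ≤ ‖γ θ - u‖ := by
      have h3 := norm_sub_norm_le u (γ θ)
      rw [norm_sub_rev] at h3
      have h4 := hR (γ θ) ⟨_, rfl⟩
      linarith
    gcongr
  have hfin : ‖windingNumber g u‖ ≤ K / (K + 1) * ‖windingNumber g w‖ := by
    rw [windingNumber_eq g u 0, norm_mul, norm_inv]
    have h5 : ‖(2 * Real.pi * Complex.I : ℂ)‖ = 2 * Real.pi := by
      simp [abs_of_pos hpi]
    rw [h5]
    calc (2 * Real.pi)⁻¹ * _ ≤ (2 * Real.pi)⁻¹ *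
        (K / ((K + 1) / ‖windingNumber g w‖) * |(0 + 2 * Real.pi) - 0|) := by gcongr
      _ = _ := by
        rw [zero_add, sub_zero, abs_of_pos Real.two_pi_pos]
        field_simp
  rw [heq] at hfin
  have : K / (K + 1) < 1 := (div_lt_one (by linarith)).2 (by linarith)
  nlinarith

/-- The winding number jumps by `1` when the curve is crossed, at a point through which it passes
once with nonzero velocity, from its right side `g ξ + t ν` to its left side `g ξ - t ν`, where
`ν` is the tangent direction rotated clockwise. -/
theorem tendsto_windingNumber_jump (hg : ContDiff ℝ 1 fun θ : ℝ => g (Circle.exp θ))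
    {ξ : Circle} (hinj : ∀ ξ', g ξ' = g ξ → ξ' = ξ) (hT : tangentVec g ξ ≠ 0) {ν : ℂ}
    (hν : (‖tangentVec g ξ‖ : ℂ) * ν = -Complex.I * tangentVec g ξ) :
    Tendsto (fun t : ℝ => windingNumber g (g ξ - t * ν) - windingNumber g (g ξ + t * ν))
      (𝓝[>] 0) (𝓝 1) := by
  obtain ⟨p, rfl⟩ := exists_circleExp_eq ξ
  set γ : ℝ → ℂ := fun θ => g (Circle.exp θ) with hγ
  have hTγ := tangentVec_exp g p
  rw [hTγ] at hT hν
  set T : ℂ := deriv γ p with hTdef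
  have hTn : (‖T‖ : ℂ) ≠ 0 := by simpa using hT
  have hν0 : ν ≠ 0 := by
    rintro rfl
    rw [mul_zero] at hν
    exact mul_ne_zero (neg_ne_zero.2 Complex.I_ne_zero) hT hν.symm
  -- in the coordinate `h = (γ - γ p) / (-ν)` the crossing takes place along the real axis
  set h : ℝ → ℂ := fun θ => (γ θ - γ p) * (-ν)⁻¹ with hh
  have hhC : ContDiff ℝ 1 h := (hg.sub contDiff_const).mul contDiff_const
  have hγd : ∀ θ, HasDerivAt γ (deriv γ θ) θ := fun θ =>
    ((hg.differentiable one_ne_zero) θ).hasDerivAt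
  have hhd : ∀ θ, HasDerivAt h (deriv γ θ * (-ν)⁻¹) θ := fun θ =>
    ((hγd θ).sub_const _).mul_const _
  have hTν : T * (-ν)⁻¹ = -(‖T‖ * Complex.I) := by
    rw [inv_neg, mul_neg, neg_inj, ← div_eq_mul_inv, div_eq_iff hν0, mul_right_comm, hν]
    linear_combination T * Complex.I_mul_I
  have him : HasDerivAt (fun θ => (h θ).im) (-‖T‖) p := by
    have h1 := hhd p
    rw [← hTdef, hTν] at h1
    have := Complex.imCLM.hasFDerivAt.comp_hasDerivAt p h1
    simpa [Function.comp_def] using this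
  have hslope := hasDerivAt_iff_tendsto_slope.1 him
  have hneg := hslope.eventually_lt_const (show -‖T‖ < 0 by simpa using hT)
  rw [eventually_nhdsWithin_iff, Metric.eventually_nhds_iff] at hneg
  obtain ⟨ε, hε, hsl⟩ := hneg
  set δ : ℝ := min (ε / 2) 1 with hδ
  have hδ0 : 0 < δ := lt_min (half_pos hε) one_pos
  have hδε : δ < ε := (min_le_left _ _).trans_lt (half_lt_self hε)
  have hδ1 : δ ≤ 1 := min_le_right _ _
  have hp0 : h p = 0 := by simp [hh]
  have hsl' : ∀ θ, |θ - p| ≤ δ → θ ≠ p → (θ - p)⁻¹ * (h θ).im < 0 := by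
    intro θ hθ hne
    have := hsl (y := θ) (by rw [Real.dist_eq]; linarith) hne
    simpa [slope, hp0] using this
  have hpi := Real.pi_gt_three
  have hjump := tendsto_integral_jump (h := h) hhC (a := p - δ) (b := p + δ) (p := p)
    (c := p - δ + 2 * Real.pi) (by linarith) (by linarith) (by linarith) hp0 ?_ ?_ ?_
  · have h2 := hjump.const_mul (2 * Real.pi * Complex.I : ℂ)⁻¹
    rw [inv_mul_cancel₀ Complex.two_pi_I_ne_zero] at h2
    refine h2.congr fun t => ?_
    rw [windingNumber_eq g _ (p - δ), windingNumber_eq g _ (p - δ), ← mul_sub]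
    congr 2
    · refine intervalIntegral.integral_congr fun θ _ => ?_
      simp only [(hhd θ).deriv]
      rw [← mul_div_mul_right (deriv γ θ) _ (inv_ne_zero (neg_ne_zero.2 hν0))]
      congr 1
      simp only [hh, hγ]
      field_simp
      ring
    · refine intervalIntegral.integral_congr fun θ _ => ?_
      simp only [(hhd θ).deriv]
      rw [← mul_div_mul_right (deriv γ θ) _ (inv_ne_zero (neg_ne_zero.2 hν0))]
      congr 1
      simp only [hh, hγ]
      field_simp
      ring
  · intro θ hθ
    have h1 := hsl' θ (by rw [abs_le]; constructor <;> linarith [hθ.1, hθ.2]) hθ.2.ne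
    have h2 : (θ - p)⁻¹ < 0 := inv_lt_zero.2 (by linarith [hθ.2])
    by_contra! h3
    nlinarith
  · intro θ hθ
    have h1 := hsl' θ (by rw [abs_le]; constructor <;> linarith [hθ.1, hθ.2]) hθ.1.ne'
    have h2 : 0 < (θ - p)⁻¹ := inv_pos.2 (by linarith [hθ.1])
    by_contra! h3
    nlinarith
  · intro θ hθ h0
    have h1 : γ θ = γ p := by
      have := (mul_eq_zero.1 h0).resolve_right (inv_ne_zero (neg_ne_zero.2 hν0))
      exact sub_eq_zero.1 this
    obtain ⟨k, hk⟩ := Circle.exp_eq_exp.1 (hinj _ h1)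
    have hk0 : (0 : ℝ) < k := by
      by_contra! hle
      nlinarith [hθ.1, hle]
    have hk1 : (k : ℝ) < 1 := by
      by_contra! hle
      nlinarith [hθ.2, hle]
    have : 0 < k := by exact_mod_cast hk0
    have : k < 1 := by exact_mod_cast hk1
    omega

end CircleCurve

/-! ### Counting the roots of a polynomial in the unit disc -/

section Count

open Polynomial

/-- The number of roots of `p` in the open unit disc, with multiplicity. -/
def rootCountDisc (p : ℂ[X]) : ℕ := p.roots.countP fun l => ‖l‖ < 1

theorem circleIntegral_inv_sub_of_one_lt_norm {r : ℂ} (hr : 1 < ‖r‖) :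
    ∮ z in C(0, 1), (z - r)⁻¹ = 0 := by
  have hne : ∀ z ∈ Metric.closedBall (0 : ℂ) 1, z - r ≠ 0 := by
    intro z hz h0
    rw [sub_eq_zero.1 h0] at hz
    simp only [mem_closedBall_zero_iff] at hz
    linarith
  refine Complex.circleIntegral_eq_zero_of_differentiable_on_off_countable zero_le_one
    countable_empty (ContinuousOn.inv₀ (by fun_prop) hne) fun z hz => ?_
  exact DifferentiableAt.inv (by fun_prop) (hne z (Metric.ball_subset_closedBall hz.1))

theorem circleIntegral_sum_inv_sub {s : Multiset ℂ} (hs : ∀ r ∈ s, ‖r‖ ≠ 1) :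
    CircleIntegrable (fun z => (s.map fun r => 1 / (z - r)).sum) 0 1 ∧
    ∮ z in C(0, 1), (s.map fun r => 1 / (z - r)).sum =
      2 * Real.pi * Complex.I * (s.countP fun l => ‖l‖ < 1 : ℕ) := by
  induction s using Multiset.induction_on with
  | empty => simp [CircleIntegrable, circleIntegral]
  | cons r s ih =>
    obtain ⟨hi, hv⟩ := ih fun q hq => hs q (Multiset.mem_cons_of_mem hq)
    have hr : ‖r‖ ≠ 1 := hs r (Multiset.mem_cons_self r s)
    have hr1 : CircleIntegrable (fun z : ℂ => 1 / (z - r)) 0 1 := by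
      refine ContinuousOn.circleIntegrable zero_le_one (ContinuousOn.div (by fun_prop)
        (by fun_prop) fun z hz h0 => hr ?_)
      rw [← sub_eq_zero.1 h0]
      simpa using hz
    simp only [Multiset.map_cons, Multiset.sum_cons, Multiset.countP_cons]
    refine ⟨hr1.add hi, ?_⟩
    rw [circleIntegral.integral_add hr1 hi, hv]
    simp only [one_div]
    rcases lt_or_gt_of_ne hr with h | h
    · rw [circleIntegral.integral_sub_inv_of_mem_ball (by simpa using h), if_pos h]
      push_cast
      ring
    · rw [circleIntegral_inv_sub_of_one_lt_norm h, if_neg h.not_gt]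
      simp

/-- The argument principle for polynomials on the unit circle. -/
theorem circleIntegral_derivative_div {p : ℂ[X]} (hp : ∀ z : ℂ, ‖z‖ = 1 → p.eval z ≠ 0) :
    ∮ z in C(0, 1), p.derivative.eval z / p.eval z =
      2 * Real.pi * Complex.I * rootCountDisc p := by
  have hp0 : p ≠ 0 := by
    rintro rfl
    exact hp 1 (by simp) (by simp)
  rw [rootCountDisc, ← (circleIntegral_sum_inv_sub fun r hr h1 =>
    hp r h1 ((mem_roots hp0).1 hr)).2]
  refine circleIntegral.integral_congr zero_le_one fun z hz => ?_
  exact (IsAlgClosed.splits p).eval_derivative_div_eval_of_ne_zero (hp z (by simpa using hz))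

/-- Evaluation of a family of polynomials of bounded degree with continuous coefficients is
jointly continuous. -/
theorem continuous_eval_of_continuous_coeff {X : Type*} [TopologicalSpace X] {p : X → ℂ[X]}
    {d : ℕ} (hd : ∀ x, (p x).natDegree ≤ d) (hp : ∀ k, Continuous fun x => (p x).coeff k)
    {Y : Type*} [TopologicalSpace Y] {u : Y → X} {v : Y → ℂ} (hu : Continuous u)
    (hv : Continuous v) : Continuous fun y => (p (u y)).eval (v y) := by
  have : ∀ y, (p (u y)).eval (v y) = ∑ k ∈ Finset.range (d + 1), (p (u y)).coeff k * v y ^ k :=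
    fun y => eval_eq_sum_range' (Nat.lt_succ_of_le (hd _)) _
  simp only [this]
  exact continuous_finsetSum _ fun k _ => ((hp k).comp hu).mul (hv.pow k)

/-- In a continuous family of polynomials without roots on the unit circle the number of roots in
the unit disc is locally constant. -/
theorem isLocallyConstant_rootCountDisc {X : Type*} [TopologicalSpace X] {p : X → ℂ[X]}
    {d : ℕ} (hd : ∀ x, (p x).natDegree ≤ d) (hp : ∀ k, Continuous fun x => (p x).coeff k)
    (hne : ∀ x, ∀ z : ℂ, ‖z‖ = 1 → (p x).eval z ≠ 0) :
    IsLocallyConstant fun x => rootCountDisc (p x) := by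
  rw [IsLocallyConstant.iff_continuous, Nat.isClosedEmbedding_coe_real.isInducing.continuous_iff]
  have hd' : ∀ x, (derivative (p x)).natDegree ≤ d := fun x =>
    (natDegree_derivative_le _).trans ((Nat.sub_le _ _).trans (hd x))
  have hp' : ∀ k, Continuous fun x => (derivative (p x)).coeff k := fun k => by
    simp only [coeff_derivative]
    exact (hp (k + 1)).mul continuous_const
  have hcont : Continuous fun x => ∮ z in C(0, 1), (p x).derivative.eval z / (p x).eval z := by
    refine intervalIntegral.continuous_parametric_intervalIntegral_of_continuous' ?_ _ _
    have hz : Continuous fun y : X × ℝ => circleMap 0 1 y.2 :=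
      (continuous_circleMap 0 1).comp continuous_snd
    simp only [Function.uncurry_def]
    refine Continuous.smul (M := ℂ) (X := ℂ) ?_ (Continuous.div
      (continuous_eval_of_continuous_coeff hd' hp' continuous_fst hz)
      (continuous_eval_of_continuous_coeff hd hp continuous_fst hz) fun y => hne _ _ (by simp))
    simp only [deriv_circleMap]
    fun_prop
  have heq : (fun x => (rootCountDisc (p x) : ℝ)) = fun x =>
      ‖∮ z in C(0, 1), (p x).derivative.eval z / (p x).eval z‖ / (2 * Real.pi) := by
    funext x
    rw [circleIntegral_derivative_div (hne x)]
    have := Real.pi_pos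
    simp only [norm_mul, Complex.norm_I, Complex.norm_natCast, Complex.norm_real,
      Complex.norm_ofNat, Real.norm_eq_abs, abs_of_pos this]
    field_simp
  change Continuous fun x => (rootCountDisc (p x) : ℝ)
  rw [heq]
  exact hcont.norm.div_const _

end Count

namespace PhotonicCrystal

variable (c : PhotonicCrystal)

/-! ### The characteristic function -/

theorem eval_charpoly_transferMatrix (ξ w : ℂ) :
    (c.transferMatrix w).charpoly.eval ξ = c.charDet ξ w := by
  rw [Matrix.eval_charpoly, charDet, ← neg_sub, Matrix.det_neg]
  simp only [Matrix.scalar_apply, Matrix.smul_one_eq_diagonal, Fintype.card_sum,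
    Fintype.card_fin]
  norm_num

theorem differentiable_transferMatrix (i j : FieldIdx) :
    Differentiable ℂ fun w => c.transferMatrix w i j := by
  obtain ⟨C, hC0, hC⟩ := c.exists_bound_coeff
  intro w
  have h : DifferentiableOn ℂ (fun w : ℂ => ∑' n : ℕ, w ^ n * c.iterInt n 1 i j)
      (Metric.ball 0 (‖w‖ + 1)) := by
    refine Complex.differentiableOn_tsum_of_summable_norm
      (Real.summable_pow_div_factorial ((‖w‖ + 1) * (4 * C) * 1))
      (fun n => (by fun_prop : Differentiable ℂ _).differentiableOn) Metric.isOpen_ball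
      fun n u hu => ?_
    refine (c.norm_term_le hC u (R := 1) (z := 1) (by simp) n i j).trans ?_
    have : ‖u‖ ≤ ‖w‖ + 1 := by simpa using (Metric.mem_ball.1 hu).le
    gcongr
  exact h.differentiableAt (Metric.isOpen_ball.mem_nhds (by simp))

theorem contDiff_charDet : ContDiff ℂ 1 fun v : ℂ × ℂ => c.charDet v.1 v.2 := by
  simp only [charDet, Matrix.det_apply, Matrix.sub_apply, Matrix.smul_apply]
  refine ContDiff.sum fun σ _ => ContDiff.const_smul _ (contDiff_prod fun i _ => ?_)
  exact (((c.differentiable_transferMatrix _ _).contDiff).comp contDiff_snd).sub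
    (contDiff_fst.smul contDiff_const)

theorem differentiable_charDet (ξ : ℂ) : Differentiable ℂ (c.charDet ξ) := by
  have h : Differentiable ℂ fun v : ℂ × ℂ => c.charDet v.1 v.2 :=
    c.contDiff_charDet.differentiable one_ne_zero
  exact h.comp (f := fun w : ℂ => (ξ, w)) (by fun_prop)

theorem natDegree_charpoly_transferMatrix (w : ℂ) :
    (c.transferMatrix w).charpoly.natDegree = 4 := by
  simp [Matrix.charpoly_natDegree_eq_dim]

theorem continuous_coeff_charpoly (k : ℕ) :
    Continuous fun w => (c.transferMatrix w).charpoly.coeff k := by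
  have h : ∀ w, (c.transferMatrix w).charpoly.coeff k = MvPolynomial.eval
      (fun ij : FieldIdx × FieldIdx => c.transferMatrix w ij.1 ij.2)
      ((Matrix.charpoly.univ ℂ FieldIdx).coeff k) := by
    intro w
    exact (Matrix.charpoly.univ_coeff_eval₂Hom FieldIdx (RingHom.id ℂ)
      (fun ij => c.transferMatrix w ij.1 ij.2) k).symm
  simp only [h]
  exact (MvPolynomial.continuous_eval _).comp
    (continuous_pi fun ij => (c.differentiable_transferMatrix ij.1 ij.2).continuous)

/-- If no eigenvalue lies on the unit circle, the index is determined by the number of eigenvalues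
in the open unit disc. -/
theorem index_eq_of_forall_ne {w : ℂ} (hw : ∀ z : ℂ, ‖z‖ = 1 → c.charDet z w ≠ 0) :
    c.index w = rootCountDisc (c.transferMatrix w).charpoly - 2 := by
  have hcard : (c.transferMatrix w).charpoly.roots.card = 4 := by
    rw [← (IsAlgClosed.splits _).natDegree_eq_card_roots, natDegree_charpoly_transferMatrix]
  have hnot : (c.transferMatrix w).charpoly.roots.countP (fun l => 1 < ‖l‖) =
      (c.transferMatrix w).charpoly.roots.countP (fun l => ¬ ‖l‖ < 1) := by
    refine Multiset.countP_congr rfl fun l hl => ?_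
    have h1 : ‖l‖ ≠ 1 := fun h1 => hw l h1 (by
      rw [← eval_charpoly_transferMatrix]
      exact (Polynomial.mem_roots (Matrix.charpoly_monic _).ne_zero).1 hl)
    simp only [not_lt, eq_iff_iff]
    exact ⟨le_of_lt, fun h => lt_of_le_of_ne h (Ne.symm h1)⟩
  have hsum := Multiset.card_eq_countP_add_countP (fun l : ℂ => ‖l‖ < 1)
    (c.transferMatrix w).charpoly.roots
  rw [hcard] at hsum
  rw [index, hnot, rootCountDisc]
  have hq : (4 : ℚ) = ((c.transferMatrix w).charpoly.roots.countP fun l => ‖l‖ < 1 : ℕ) +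
      ((c.transferMatrix w).charpoly.roots.countP fun l => ¬ ‖l‖ < 1 : ℕ) := by
    exact_mod_cast hsum
  linarith

end PhotonicCrystal

/-! ### Local branches of eigenvalues and eigenfrequencies -/

/-- The implicit function theorem for a complex equation `f (z, w) = 0` with nonzero derivative in
`w`, including local uniqueness. -/
theorem exists_implicit_branch {f : ℂ × ℂ → ℂ} (hf : ContDiff ℂ 1 f) {a b : ℂ}
    (h0 : f (a, b) = 0) (hd : deriv (fun w => f (a, w)) b ≠ 0) :
    ∃ G : ℂ → ℂ, ContDiffAt ℂ 1 G a ∧ G a = b ∧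
      ∀ᶠ v in 𝓝 (a, b), f v = 0 ↔ G v.1 = v.2 := by
  have hfd : HasFDerivAt f (fderiv ℂ f (a, b)) (a, b) :=
    (hf.differentiable one_ne_zero (a, b)).hasFDerivAt
  have hcomp : HasDerivAt (fun w => f (a, w)) (fderiv ℂ f (a, b) (0, 1)) b :=
    hfd.comp_hasDerivAt b ((hasDerivAt_const b a).prodMk (hasDerivAt_id b))
  rw [hcomp.deriv] at hd
  have hinv : (fderiv ℂ f (a, b) ∘L .inr ℂ ℂ ℂ).IsInvertible := by
    refine ⟨ContinuousLinearEquiv.unitsEquivAut ℂ (Units.mk0 _ hd), ?_⟩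
    ext
    simp
  have hc : ContDiffAt ℂ 1 f (a, b) := hf.contDiffAt
  refine ⟨hc.implicitFunction one_ne_zero hinv, hc.contDiffAt_implicitFunction _ _,
    hc.implicitFunction_apply_self _ _, ?_⟩
  simpa [h0] using hc.eventually_apply_eq_iff_implicitFunction one_ne_zero hinv

/-- A real function with positive derivative at `0` exceeds its value there immediately to the
right, and stays below it immediately to the left. -/
theorem eventually_lt_and_lt_of_hasDerivAt_pos {φ : ℝ → ℝ} {d : ℝ} (hφ : HasDerivAt φ d 0)
    (hd : 0 < d) : ∀ᶠ t in 𝓝[>] (0 : ℝ), φ 0 < φ t ∧ φ (-t) < φ 0 := by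
  have h := (hasDerivAt_iff_tendsto_slope.1 hφ).eventually_const_lt hd
  rw [eventually_nhdsWithin_iff, Metric.eventually_nhds_iff] at h
  obtain ⟨ε, hε, h⟩ := h
  filter_upwards [Ioo_mem_nhdsGT hε] with t ht
  have h1 := h (y := t) (by simpa [abs_of_pos ht.1] using ht.2) ht.1.ne'
  have h2 := h (y := -t) (by simpa [abs_of_pos ht.1] using ht.2) (by simpa using ht.1.ne')
  simp only [slope, sub_zero, vsub_eq_sub, smul_eq_mul] at h1 h2
  have h3 : 0 < t⁻¹ := inv_pos.2 ht.1
  rw [inv_neg] at h2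
  constructor
  · by_contra! hle
    nlinarith
  · by_contra! hle
    nlinarith

namespace PhotonicCrystal

variable (c : PhotonicCrystal)

/-- Suppose that `ξ₀` is the only unimodular eigenvalue of `ℳ(G ξ₀)`, where `G` is a local branch
of eigenfrequencies with simple zeros and nonzero derivative at `ξ₀`. The local inverse `lam` of
`G` is then a branch of eigenvalues that leaves the unit disc in the direction of `ξ₀ G'(ξ₀)`, and
the remaining factor of the characteristic polynomial has no unimodular root at `G ξ₀`. Thus one
more eigenvalue lies in the disc on the side `G ξ₀ - t ν` than on the side `G ξ₀ + t ν`. -/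
theorem exists_rootCountDisc_jump {G : ℂ → ℂ} {ξ₀ ν : ℂ} {r : ℝ} (hξ : ‖ξ₀‖ = 1)
    (hG : ContDiffAt ℂ 1 G ξ₀) (hGF : ∀ᶠ z in 𝓝 ξ₀, c.charDet z (G z) = 0)
    (hG' : deriv G ξ₀ ≠ 0) (hsimple : deriv (c.charDet ξ₀) (G ξ₀) ≠ 0)
    (honly : ∀ z : ℂ, ‖z‖ = 1 → c.charDet z (G ξ₀) = 0 → z = ξ₀)
    (hr : 0 < r) (hν : ν = r * (ξ₀ * deriv G ξ₀)) :
    ∃ m : ℕ, ∀ᶠ t : ℝ in 𝓝[>] 0,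
      ((∀ z : ℂ, ‖z‖ = 1 → c.charDet z (G ξ₀ + t * ν) ≠ 0) →
        rootCountDisc (c.transferMatrix (G ξ₀ + t * ν)).charpoly = m) ∧
      ((∀ z : ℂ, ‖z‖ = 1 → c.charDet z (G ξ₀ - t * ν) ≠ 0) →
        rootCountDisc (c.transferMatrix (G ξ₀ - t * ν)).charpoly = m + 1) := by
  classical
  set ζ := G ξ₀ with hζ
  -- the branch of eigenvalues
  have hs : HasStrictDerivAt G (deriv G ξ₀) ξ₀ := hG.hasStrictDerivAt one_ne_zero
  obtain ⟨lam, hlam, hlam0, hright⟩ : ∃ lam : ℂ → ℂ,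
      HasStrictDerivAt lam (deriv G ξ₀)⁻¹ ζ ∧ lam ζ = ξ₀ ∧ ∀ᶠ w in 𝓝 ζ, G (lam w) = w :=
    ⟨_, hs.to_localInverse hG',
      HasStrictFDerivAt.localInverse_apply_image (hs.hasStrictFDerivAt_equiv hG'),
      HasStrictFDerivAt.eventually_right_inverse (hs.hasStrictFDerivAt_equiv hG')⟩
  have hroot : ∀ᶠ w in 𝓝 ζ, c.charDet (lam w) w = 0 := by
    have h1 : Tendsto lam (𝓝 ζ) (𝓝 ξ₀) := by
      have := hlam.hasDerivAt.continuousAt.tendsto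
      rwa [hlam0] at this
    filter_upwards [hright, h1.eventually hGF] with w hw1 hw2
    rwa [hw1] at hw2
  obtain ⟨K, N₁, hN₁, hlip⟩ := hlam.hasStrictFDerivAt.exists_lipschitzOnWith
  -- the complementary factor of the characteristic polynomial
  set q : ℂ → Polynomial ℂ := fun w =>
    (c.transferMatrix w).charpoly /ₘ (Polynomial.X - Polynomial.C (lam w)) with hq
  have hfac : ∀ w, c.charDet (lam w) w = 0 →
      (Polynomial.X - Polynomial.C (lam w)) * q w = (c.transferMatrix w).charpoly := by
    intro w hw
    rw [hq, Polynomial.mul_divByMonic_eq_iff_isRoot, Polynomial.IsRoot,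
      eval_charpoly_transferMatrix, hw]
  set S : Set ℂ := {w | w ∈ N₁ ∧ ∀ z : ℂ, ‖z‖ = 1 → (q w).eval z ≠ 0} with hS
  have hlc : IsLocallyConstant fun w : S => rootCountDisc (q w) := by
    refine isLocallyConstant_rootCountDisc (d := 4) (fun w => ?_) (fun k => ?_) fun w => w.2.2
    · refine (Polynomial.natDegree_divByMonic _ (Polynomial.monic_X_sub_C _)).le.trans ?_
      rw [natDegree_charpoly_transferMatrix]
      exact Nat.sub_le _ _
    · simp only [hq, Polynomial.coeff_divByMonic_X_sub_C, natDegree_charpoly_transferMatrix]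
      have hcl : Continuous fun w : S => lam w :=
        continuousOn_iff_continuous_domRestrict.1 (hlip.continuousOn.mono fun w hw => hw.1)
      exact continuous_finsetSum _ fun i _ => (hcl.pow _).mul
        ((c.continuous_coeff_charpoly i).comp continuous_subtype_val)
  have hζS : ζ ∈ S := by
    refine ⟨mem_of_mem_nhds hN₁, fun z hz hz0 => ?_⟩
    have hf := hfac ζ hroot.self_of_nhds
    rw [hlam0] at hf
    have hev : ∀ y, c.charDet y ζ = (y - ξ₀) * (q ζ).eval y := by
      intro y
      rw [← eval_charpoly_transferMatrix, ← hf]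
      simp
    obtain rfl : z = ξ₀ := honly z hz (by rw [hev, hz0, mul_zero])
    -- `ξ₀` would be a double eigenvalue, which contradicts `F_ξ = - F_ω G' ≠ 0`
    have hfd : HasFDerivAt (fun v : ℂ × ℂ => c.charDet v.1 v.2)
        (fderiv ℂ (fun v : ℂ × ℂ => c.charDet v.1 v.2) (z, ζ)) (z, ζ) :=
      (c.contDiff_charDet.differentiable one_ne_zero (z, ζ)).hasFDerivAt
    set L := fderiv ℂ (fun v : ℂ × ℂ => c.charDet v.1 v.2) (z, ζ)
    have h1 : HasDerivAt (fun y => c.charDet y ζ) (L (1, 0)) z :=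
      hfd.comp_hasDerivAt (f := fun y => (y, ζ)) z
        ((hasDerivAt_id' z).prodMk (hasDerivAt_const z ζ))
    have h2 : HasDerivAt (c.charDet z) (L (0, 1)) ζ :=
      hfd.comp_hasDerivAt ζ ((hasDerivAt_const ζ z).prodMk (hasDerivAt_id ζ))
    have h3 : HasDerivAt (fun y => c.charDet y (G y)) (L (1, deriv G z)) z :=
      hfd.comp_hasDerivAt (f := fun y => (y, G y)) z
        ((hasDerivAt_id' z).prodMk hs.hasDerivAt)
    have h1' : HasDerivAt (fun y => c.charDet y ζ) 0 z := by
      simp only [hev]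
      have := ((hasDerivAt_id' z).sub_const z).fun_mul ((q ζ).hasDerivAt z)
      rwa [hz0, sub_self, zero_mul, mul_zero, add_zero] at this
    have h3' : HasDerivAt (fun y => c.charDet y (G y)) 0 z :=
      (hasDerivAt_const z (0 : ℂ)).congr_of_eventuallyEq hGF
    have e1 : L (1, 0) = 0 := h1.unique h1'
    have e3 : L (1, deriv G z) = 0 := h3.unique h3'
    have e4 : L (1, deriv G z) = L (1, 0) + deriv G z * L (0, 1) := by
      rw [← smul_eq_mul, ← map_smul, ← map_add]
      simp
    rw [e3, e1, zero_add, ← h2.deriv] at e4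
    exact mul_ne_zero hG' hsimple e4.symm
  have hev : ∀ᶠ w in 𝓝 ζ, w ∈ S → rootCountDisc (q w) = rootCountDisc (q ζ) := by
    have h1 := hlc.eventually_eq ⟨ζ, hζS⟩
    rw [nhds_subtype_eq_comap, eventually_comap] at h1
    exact h1.mono fun w hw hwS => hw ⟨w, hwS⟩ rfl
  have hcount : ∀ᶠ w in 𝓝 ζ, (∀ z : ℂ, ‖z‖ = 1 → c.charDet z w ≠ 0) →
      rootCountDisc (c.transferMatrix w).charpoly =
        rootCountDisc (q ζ) + if ‖lam w‖ < 1 then 1 else 0 := by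
    filter_upwards [hev, hroot, hN₁] with w h1 h2 h3 h4
    have hf := hfac w h2
    have hne : (Polynomial.X - Polynomial.C (lam w)) * q w ≠ 0 := by
      rw [hf]
      exact (Matrix.charpoly_monic _).ne_zero
    rw [← h1 ⟨h3, fun z hz h0 => h4 z hz ?_⟩]
    · simp only [rootCountDisc]
      rw [← hf, Polynomial.roots_mul hne, Multiset.countP_add, Polynomial.roots_X_sub_C,
        ← Multiset.cons_zero, Multiset.countP_cons, Multiset.countP_zero, zero_add, add_comm]
    · rw [← eval_charpoly_transferMatrix, ← hf, Polynomial.eval_mul, h0, mul_zero]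
  -- the branch of eigenvalues leaves the disc in the direction `ν`
  have hline : ∀ σ : ℝ, Tendsto (fun t : ℝ => ζ + ((σ * t : ℝ) : ℂ) * ν) (𝓝[>] 0) (𝓝 ζ) := by
    intro σ
    have : Continuous fun t : ℝ => ζ + ((σ * t : ℝ) : ℂ) * ν := by fun_prop
    simpa using (this.tendsto 0).mono_left nhdsWithin_le_nhds
  have hφ : HasDerivAt (fun t : ℝ => ‖lam (ζ + t * ν)‖ ^ 2) (2 * r) 0 := by
    have hl : HasDerivAt (fun t : ℝ => ζ + (t : ℂ) * ν) ν 0 := by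
      simpa using ((Complex.ofRealCLM.hasDerivAt (x := (0 : ℝ))).mul_const ν).const_add ζ
    have hl2 : HasDerivAt (fun t : ℝ => lam (ζ + t * ν)) ((deriv G ξ₀)⁻¹ * ν) 0 := by
      have h0 : HasDerivAt lam (deriv G ξ₀)⁻¹ (ζ + ((0 : ℝ) : ℂ) * ν) := by
        simpa using hlam.hasDerivAt
      exact h0.comp (0 : ℝ) hl
    have hval : (deriv G ξ₀)⁻¹ * ν = r • ξ₀ := by
      rw [hν, Complex.real_smul]
      field_simp
    have := hl2.norm_sq
    rw [hval] at this
    simpa only [Complex.ofReal_zero, zero_mul, add_zero, hlam0, real_inner_smul_right,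
      real_inner_self_eq_norm_sq, hξ, one_pow, mul_one] using this
  have hsign := eventually_lt_and_lt_of_hasDerivAt_pos hφ (by linarith)
  refine ⟨rootCountDisc (q ζ), ?_⟩
  filter_upwards [hsign, (hline 1).eventually hcount, (hline (-1)).eventually hcount]
    with t ht h1 h2
  have e2 : ζ + ((-1 * t : ℝ) : ℂ) * ν = ζ - t * ν := by
    push_cast
    ring
  have e3 : ζ + ((-t : ℝ) : ℂ) * ν = ζ - t * ν := by
    push_cast
    ring
  simp only [one_mul] at h1
  rw [e2] at h2
  simp only [e3, Complex.ofReal_zero, zero_mul, add_zero, hlam0, hξ, one_pow] at ht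
  refine ⟨fun h => ?_, fun h => ?_⟩
  · rw [h1 h, if_neg, add_zero]
    exact fun hlt => absurd ht.1 (not_lt.2 (pow_le_one₀ (norm_nonneg _) hlt.le))
  · rw [h2 h, if_pos]
    by_contra! hge
    exact absurd ht.2 (not_lt.2 (one_le_pow₀ hge))

/-! ### Isolated bands -/

section Bands

variable {c} {ι : Type*} {ω : ι → Circle → ℂ}

theorem IsBandLabelling.charDet_eq_zero_iff (hω : c.IsBandLabelling ω) (ξ : Circle) (w : ℂ) :
    c.charDet ξ w = 0 ↔ ∃ m, ω m ξ = w := by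
  have han : AnalyticAt ℂ (c.charDet ξ) w := (c.differentiable_charDet ξ).analyticAt w
  rw [← han.analyticOrderAt_ne_zero, ← hω.2 ξ w, Set.encard_ne_zero]
  rfl

theorem IsBandLabelling.charDet_ne_zero (hω : c.IsBandLabelling ω) {w : ℂ}
    (hw : w ∈ (dispersionSet ω)ᶜ) (z : ℂ) (hz : ‖z‖ = 1) : c.charDet z w ≠ 0 := by
  intro h0
  obtain ⟨m, hm⟩ := (hω.charDet_eq_zero_iff ⟨z, mem_sphere_zero_iff_norm.2 hz⟩ w).1 h0
  exact hw (mem_iUnion.2 ⟨m, _, hm⟩)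

/-- The eigenfrequencies on a band that meets no other band are simple zeros. -/
theorem IsBandLabelling.deriv_charDet_ne_zero (hω : c.IsBandLabelling ω) {n : ι}
    (hdisj : ∀ m, m ≠ n → Disjoint (range (ω n)) (range (ω m))) (ξ : Circle) :
    deriv (c.charDet ξ) (ω n ξ) ≠ 0 := by
  have han : AnalyticAt ℂ (c.charDet ξ) (ω n ξ) :=
    (c.differentiable_charDet ξ).analyticAt _
  have hset : {m | ω m ξ = ω n ξ} = {n} := by
    ext m
    refine ⟨fun hm => ?_, fun hm => by rw [mem_singleton_iff.1 hm]; rfl⟩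
    by_contra hne
    exact disjoint_left.1 (hdisj m hne) ⟨ξ, rfl⟩ ⟨ξ, hm⟩
  have hord : analyticOrderAt (c.charDet ξ) (ω n ξ) = 1 := by
    rw [← hω.2 ξ, hset, encard_singleton]
  have h0 : c.charDet ξ (ω n ξ) = 0 := (hω.charDet_eq_zero_iff ξ _).2 ⟨n, rfl⟩
  have h1 := han.analyticOrderAt_deriv_add_one
  simp only [h0, sub_zero] at h1
  rw [hord] at h1
  have h2 : analyticOrderAt (deriv (c.charDet ξ)) (ω n ξ) = 0 := by
    have := h1.trans (zero_add 1).symm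
    exact (ENat.add_left_injective_of_ne_top ENat.one_ne_top) this
  exact (han.deriv.analyticOrderAt_eq_zero).1 h2

/-- A band that meets no other band is locally the restriction to the circle of a holomorphic
branch of eigenfrequencies. -/
theorem IsBandLabelling.exists_local_branch (hω : c.IsBandLabelling ω) {n : ι}
    (hdisj : ∀ m, m ≠ n → Disjoint (range (ω n)) (range (ω m))) (ξ : Circle) :
    ∃ G : ℂ → ℂ, ContDiffAt ℂ 1 G ξ ∧ G ξ = ω n ξ ∧ (∀ᶠ z in 𝓝 (ξ : ℂ), c.charDet z (G z) = 0) ∧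
      ∀ᶠ ξ' in 𝓝 ξ, ω n ξ' = G ξ' := by
  have h0 : ∀ ξ' : Circle, c.charDet ξ' (ω n ξ') = 0 := fun ξ' =>
    (hω.charDet_eq_zero_iff ξ' _).2 ⟨n, rfl⟩
  obtain ⟨G, hG, hGξ, hGF⟩ := exists_implicit_branch c.contDiff_charDet (h0 ξ)
    (hω.deriv_charDet_ne_zero hdisj ξ)
  refine ⟨G, hG, hGξ, ?_, ?_⟩
  · have ht : Tendsto (fun z => (z, G z)) (𝓝 (ξ : ℂ)) (𝓝 ((ξ : ℂ), ω n ξ)) := by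
      have := hG.continuousAt.tendsto
      rw [hGξ] at this
      exact tendsto_id.prodMk_nhds this
    exact (ht.eventually hGF).mono fun z hz => hz.2 rfl
  · have ht : Tendsto (fun ξ' : Circle => ((ξ' : ℂ), ω n ξ')) (𝓝 ξ) (𝓝 ((ξ : ℂ), ω n ξ)) :=
      (continuous_subtype_val.tendsto ξ).prodMk_nhds ((hω.1 n).tendsto ξ)
    exact (ht.eventually hGF).mono fun ξ' h => (h.1 (h0 ξ')).symm

theorem IsBandLabelling.contDiff_band (hω : c.IsBandLabelling ω) {n : ι}
    (hdisj : ∀ m, m ≠ n → Disjoint (range (ω n)) (range (ω m))) :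
    ContDiff ℝ 1 fun θ : ℝ => ω n (Circle.exp θ) := by
  refine contDiff_iff_contDiffAt.2 fun θ => ?_
  obtain ⟨G, hG, -, -, heq⟩ := hω.exists_local_branch hdisj (Circle.exp θ)
  have hexp : ContDiff ℝ 1 fun θ : ℝ => ((Circle.exp θ : Circle) : ℂ) := by
    simp only [Circle.coe_exp]
    exact (Complex.ofRealCLM.contDiff.mul contDiff_const).cexp
  have hcomp : ContDiffAt ℝ 1 (fun θ : ℝ => G (Circle.exp θ)) θ :=
    ContDiffAt.comp θ (hG.restrict_scalars ℝ) hexp.contDiffAt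
  exact hcomp.congr_of_eventuallyEq ((Circle.exp.continuous.tendsto θ).eventually heq)

end Bands

end PhotonicCrystal

/-- In terms of a local holomorphic extension `G`, the tangent vector is `i ξ G'(ξ)`. -/
theorem tangentVec_eq_of_eventuallyEq {g : Circle → ℂ} {ξ : Circle} {G : ℂ → ℂ}
    (hG : DifferentiableAt ℂ G ξ) (heq : ∀ᶠ ξ' in 𝓝 ξ, g ξ' = G ξ') :
    tangentVec g ξ = Complex.I * (ξ * deriv G ξ) := by
  have hexp : HasDerivAt (fun t : ℝ => (ξ : ℂ) * (Circle.exp t : Circle)) (ξ * Complex.I) 0 := by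
    have h1 : HasDerivAt (fun t : ℝ => (t : ℂ) * Complex.I) (1 * Complex.I) 0 :=
      (Complex.ofRealCLM.hasDerivAt (x := (0 : ℝ))).mul_const _
    have := h1.cexp.const_mul (ξ : ℂ)
    simpa [Circle.coe_exp] using this
  have hG0 : HasDerivAt G (deriv G ξ) ((ξ : ℂ) * (Circle.exp (0 : ℝ) : Circle)) := by
    simpa using hG.hasDerivAt
  have hcomp := hG0.comp (0 : ℝ) hexp
  have hc : Continuous fun t : ℝ => ξ * Circle.exp t :=
    continuous_const.mul Circle.exp.continuous
  have ht : Tendsto (fun t : ℝ => ξ * Circle.exp t) (𝓝 0) (𝓝 ξ) := by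
    simpa using hc.tendsto 0
  rw [tangentVec, (hcomp.congr_of_eventuallyEq (ht.eventually heq)).deriv]
  ring

/-! ### Orientation, and the crossing of an isolated band -/

/-- A unit vector orthogonal to the nonzero vector `T` is the direction of `T` rotated by a right
angle, clockwise or counterclockwise. -/
theorem norm_mul_eq_or_of_inner_eq_zero {ν T : ℂ} (hν : ‖ν‖ = 1) (h : inner ℝ ν T = 0) :
    (‖T‖ : ℂ) * ν = -Complex.I * T ∨ (‖T‖ : ℂ) * (-ν) = -Complex.I * T := by
  have hre : (T * (starRingEnd ℂ) ν).re = 0 := h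
  set y : ℝ := (T * (starRingEnd ℂ) ν).im with hy
  have h1 : T * (starRingEnd ℂ) ν = y * Complex.I := by
    apply Complex.ext <;> simp [hre, hy]
  have h2 : (starRingEnd ℂ) ν * ν = 1 := by
    rw [mul_comm, Complex.mul_conj, Complex.normSq_eq_norm_sq, hν]
    simp
  have h3 : T = y * Complex.I * ν := by
    rw [← h1, mul_assoc, h2, mul_one]
  have h4 : ‖T‖ = |y| := by
    rw [h3]
    simp [hν]
  have h5 : -Complex.I * T = y * ν := by
    rw [h3]
    linear_combination (-(y : ℂ) * ν) * Complex.I_mul_I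
  rw [h4, h5]
  rcases abs_choice y with h6 | h6
  · left; rw [h6]
  · right; rw [h6]; push_cast; ring

/-- The winding number around a component is `1` if, at some smooth point, the outward
normal is the tangent direction rotated clockwise: it is `0` on the other side of the curve. -/
theorem windingNumber_eq_one_of_isOutwardNormal {g : Circle → ℂ}
    (hg : ContDiff ℝ 1 fun θ : ℝ => g (Circle.exp θ)) {U : Set ℂ}
    (hU : IsComponentOf U (range g)ᶜ) {ξ : Circle} {ν : ℂ} (hs : IsSmoothPoint g ξ)
    (hν : IsOutwardNormal g U ξ ν)
    (hor : (‖tangentVec g ξ‖ : ℂ) * ν = -Complex.I * tangentVec g ξ) {w : ℂ} (hw : w ∈ U) :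
    windingNumber g w = 1 := by
  obtain ⟨w₀, -, rfl⟩ := hU
  have hj := tendsto_windingNumber_jump hg hs.1 hs.2.2 hor
  refine tendsto_nhds_unique (tendsto_const_nhds.congr' ?_) hj
  filter_upwards [hν.2.2] with t ht
  rw [windingNumber_eq_zero_of_mem_exteriorOf hg ht.1, sub_zero]
  exact windingNumber_eq_of_mem_connectedComponentIn hg hw ht.2

/-- The winding number around a component is `-1` if, at some smooth point, the outward
normal is the tangent direction rotated counterclockwise. -/
theorem windingNumber_eq_neg_one_of_isOutwardNormal {g : Circle → ℂ}
    (hg : ContDiff ℝ 1 fun θ : ℝ => g (Circle.exp θ)) {U : Set ℂ}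
    (hU : IsComponentOf U (range g)ᶜ) {ξ : Circle} {ν : ℂ} (hs : IsSmoothPoint g ξ)
    (hν : IsOutwardNormal g U ξ ν)
    (hor : (‖tangentVec g ξ‖ : ℂ) * (-ν) = -Complex.I * tangentVec g ξ) {w : ℂ} (hw : w ∈ U) :
    windingNumber g w = -1 := by
  obtain ⟨w₀, -, rfl⟩ := hU
  have hj := (tendsto_windingNumber_jump hg hs.1 hs.2.2 hor).neg
  refine tendsto_nhds_unique (tendsto_const_nhds.congr' ?_) hj
  filter_upwards [hν.2.2] with t ht
  rw [mul_neg, sub_neg_eq_add, ← sub_eq_add_neg,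
    windingNumber_eq_zero_of_mem_exteriorOf hg ht.1, zero_sub, neg_neg]
  exact windingNumber_eq_of_mem_connectedComponentIn hg hw ht.2

namespace PhotonicCrystal

variable {c : PhotonicCrystal} {ι : Type*} {ω : ι → Circle → ℂ}

theorem IsBandLabelling.rootCountDisc_eq (hω : c.IsBandLabelling ω) {D : Set ℂ}
    (hD : IsComponentOf D (dispersionSet ω)ᶜ) {u v : ℂ} (hu : u ∈ D) (hv : v ∈ D) :
    rootCountDisc (c.transferMatrix u).charpoly = rootCountDisc (c.transferMatrix v).charpoly := by
  obtain ⟨w₀, -, rfl⟩ := hD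
  have hlc : IsLocallyConstant fun w : connectedComponentIn (dispersionSet ω)ᶜ w₀ =>
      rootCountDisc (c.transferMatrix w).charpoly :=
    isLocallyConstant_rootCountDisc (d := 4)
      (fun w => (c.natDegree_charpoly_transferMatrix w).le)
      (fun k => (c.continuous_coeff_charpoly k).comp continuous_subtype_val)
      fun w z hz => by
        rw [eval_charpoly_transferMatrix]
        exact hω.charDet_ne_zero (connectedComponentIn_subset _ _ w.2) z hz
  have : PreconnectedSpace (connectedComponentIn (dispersionSet ω)ᶜ w₀) :=
    Subtype.preconnectedSpace isPreconnected_connectedComponentIn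
  exact hlc.apply_eq_of_preconnectedSpace ⟨u, hu⟩ ⟨v, hv⟩

theorem IsBandLabelling.index_eq (hω : c.IsBandLabelling ω) {D : Set ℂ}
    (hD : IsComponentOf D (dispersionSet ω)ᶜ) {w : ℂ} (hw : w ∈ D) :
    c.index w = rootCountDisc (c.transferMatrix w).charpoly - 2 := by
  refine c.index_eq_of_forall_ne fun z hz => hω.charDet_ne_zero ?_ z hz
  obtain ⟨w₀, -, rfl⟩ := hD
  exact connectedComponentIn_subset _ _ hw

/-- The index increases by `1` when an isolated band is crossed, at a smooth point, from its right
side to its left side. -/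
theorem IsBandLabelling.index_eq_index_add_one (hω : c.IsBandLabelling ω) {n : ι}
    (hdisj : ∀ m, m ≠ n → Disjoint (range (ω n)) (range (ω m))) {R L : Set ℂ}
    (hR : IsComponentOf R (dispersionSet ω)ᶜ) (hL : IsComponentOf L (dispersionSet ω)ᶜ)
    {ξ : Circle} {ν : ℂ} (hs : IsSmoothPoint (ω n) ξ)
    (hor : (‖tangentVec (ω n) ξ‖ : ℂ) * ν = -Complex.I * tangentVec (ω n) ξ)
    (hadj : ∀ᶠ t : ℝ in 𝓝[>] 0, ω n ξ + t * ν ∈ R ∧ ω n ξ - t * ν ∈ L) {u v : ℂ}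
    (hu : u ∈ R) (hv : v ∈ L) : c.index v = c.index u + 1 := by
  obtain ⟨G, hG, hGξ, hGF, heq⟩ := hω.exists_local_branch hdisj ξ
  have hT := tangentVec_eq_of_eventuallyEq (hG.differentiableAt one_ne_zero) heq
  have hT0 := hs.2.2
  have hG' : deriv G ξ ≠ 0 := by
    intro h0
    rw [hT, h0] at hT0
    simp at hT0
  have hpos : 0 < ‖tangentVec (ω n) ξ‖ := norm_pos_iff.2 hT0
  have hν : ν = ((‖tangentVec (ω n) ξ‖⁻¹ : ℝ) : ℂ) * (ξ * deriv G ξ) := by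
    have h1 : (‖tangentVec (ω n) ξ‖ : ℂ) ≠ 0 := by exact_mod_cast hpos.ne'
    have h2 : (ξ : ℂ) * deriv G ξ = (‖tangentVec (ω n) ξ‖ : ℂ) * ν := by
      rw [hor, hT]
      linear_combination (ξ * deriv G ξ : ℂ) * Complex.I_mul_I
    rw [h2, Complex.ofReal_inv, inv_mul_cancel_left₀ h1]
  have honly : ∀ z : ℂ, ‖z‖ = 1 → c.charDet z (G ξ) = 0 → z = ξ := by
    intro z hz h0
    rw [hGξ] at h0
    obtain ⟨m, hm⟩ := (hω.charDet_eq_zero_iff ⟨z, mem_sphere_zero_iff_norm.2 hz⟩ _).1 h0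
    obtain rfl : m = n := by
      by_contra hne
      exact disjoint_left.1 (hdisj m hne) ⟨ξ, rfl⟩ ⟨_, hm⟩
    exact congrArg Subtype.val (hs.1 _ hm)
  obtain ⟨k, hk⟩ := c.exists_rootCountDisc_jump (Circle.norm_coe ξ) hG hGF hG'
    (by rw [hGξ]; exact hω.deriv_charDet_ne_zero hdisj ξ) honly (inv_pos.2 hpos) hν
  rw [hGξ] at hk
  obtain ⟨t, ht, htR, htL⟩ := (hk.and hadj).exists
  have hc : ∀ {E : Set ℂ}, IsComponentOf E (dispersionSet ω)ᶜ → ∀ {w}, w ∈ E →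
      ∀ z : ℂ, ‖z‖ = 1 → c.charDet z w ≠ 0 := by
    rintro _ ⟨w₀, -, rfl⟩ w hw
    exact hω.charDet_ne_zero (connectedComponentIn_subset _ _ hw)
  rw [hω.index_eq hL hv, hω.index_eq hR hu, hω.rootCountDisc_eq hL hv htL,
    hω.rootCountDisc_eq hR hu htR, ht.1 (hc hR htR), ht.2 (hc hL htL)]
  push_cast
  ring

/-- All points of a principal gapped component have index `0`. -/
theorem IsBandLabelling.index_eq_zero (hω : c.IsBandLabelling ω) {D : Set ℂ}
    (hD : IsPrincipalGapped c ω D) {w : ℂ} (hw : w ∈ D) : c.index w = 0 := by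
  obtain ⟨hD, u, hu, h0⟩ := hD
  rw [← h0, hω.index_eq hD hw, hω.index_eq hD hu, hω.rootCountDisc_eq hD hw hu]

end PhotonicCrystal

end

theorem mainTheorem2 (c : PhotonicCrystal) {ι : Type*} (ω : ι → Circle → ℂ)
    (hω : c.IsBandLabelling ω)
    -- the curve `γₙ` meets no other dispersion curve
    (n : ι) (hdisj : ∀ m, m ≠ n → Disjoint (range (ω n)) (range (ω m)))
    -- the principal gapped component `D`
    (D : Set ℂ) (hD : IsPrincipalGapped c ω D)
    -- the bounded component `U = Dₙⁱ` cut out by `γₙ`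
    (U : Set ℂ) (hU : IsComponentOf U (range (ω n))ᶜ) (hUb : Bornology.IsBounded U)
    -- the component `V` of `Γᶜ` in `U` (`V = U` if `U` contains no point of another curve)
    (V : Set ℂ) (hV : IsComponentOf V (dispersionSet ω)ᶜ) (hVU : V ⊆ U)
    -- `D` and `V` are adjacent at a smooth point of `γₙ`, where `ωₙ` is analytic
    (ξ₀ : Circle) (ν : ℂ) (hsmooth : IsSmoothPoint (ω n) ξ₀)
    (hν : IsOutwardNormal (ω n) U ξ₀ ν)
    (hadj : ∀ᶠ t : ℝ in 𝓝[>] 0, ω n ξ₀ + t * ν ∈ D ∧ ω n ξ₀ - t * ν ∈ V)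
    (hana : IsAnalyticAtCircle (ω n) ξ₀) :
    ContDiff ℝ 1 (fun θ : ℝ => ω n (Circle.exp θ)) ∧
    (IsPositivelyOriented (ω n) U →
      (∀ w ∈ V, c.index w = 1) ∧ ∀ w ∈ U, windingNumber (ω n) w = 1) ∧
    (¬ IsPositivelyOriented (ω n) U →
      (∀ w ∈ V, c.index w = -1) ∧ ∀ w ∈ U, windingNumber (ω n) w = -1) := by
  have hg := hω.contDiff_band hdisj
  obtain ⟨w₀, hw₀⟩ : ∃ w, w ∈ D := ⟨_, hadj.exists.choose_spec.1⟩
  have hD0 := hω.index_eq_zero hD hw₀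
  obtain ⟨u₀, hu₀⟩ : ∃ u, u ∈ U := ⟨_, hν.2.2.exists.choose_spec.2⟩
  refine ⟨hg, ?_⟩
  rcases norm_mul_eq_or_of_inner_eq_zero hν.1 hν.2.1 with hor | hor
  · refine ⟨fun _ => ⟨fun w hw => ?_, fun w hw =>
      windingNumber_eq_one_of_isOutwardNormal hg hU hsmooth hν hor hw⟩,
      fun hneg => absurd ⟨ξ₀, ν, hsmooth, hν, hor⟩ hneg⟩
    rw [hω.index_eq_index_add_one hdisj hD.1 hV hsmooth hor hadj hw₀ hw, hD0, zero_add]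
  · refine ⟨fun ⟨ξ₁, ν₁, hs₁, hν₁, hor₁⟩ => ?_, fun _ => ⟨fun w hw => ?_, fun w hw =>
      windingNumber_eq_neg_one_of_isOutwardNormal hg hU hsmooth hν hor hw⟩⟩
    · -- the orientation does not depend on the smooth point: both values are `W(γₙ; u₀)`
      have h1 := windingNumber_eq_one_of_isOutwardNormal hg hU hs₁ hν₁ hor₁ hu₀
      have h2 := windingNumber_eq_neg_one_of_isOutwardNormal hg hU hsmooth hν hor hu₀
      rw [h1] at h2
      norm_num at h2
    · have hadj' : ∀ᶠ t : ℝ in 𝓝[>] 0, ω n ξ₀ + t * (-ν) ∈ V ∧ ω n ξ₀ - t * (-ν) ∈ D := by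
        filter_upwards [hadj] with t ht
        simpa [← sub_eq_add_neg] using ht.symm
      have h1 := hω.index_eq_index_add_one hdisj hV hD.1 hsmooth hor hadj' hw hw₀
      linarith
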